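/- Let $G$ be a finite loopless multigraph of maximum degree at most $3$, each of whose edges is either a c-edge or a d-edge; edges of both kinds count towards the degree, with multiplicity, and parallel edges (of the same or of different kinds) are allowed. For a vertex $v$ let $N_d[v]=\{v\}\cup\{u : uv \text{ is a d-edge}\}$ be its closed d-neighbourhood. Call a set $X\subseteq V(G)$ \emph{2-limited} if $|X\cap\{u,v\}|\le 1$ for every c-edge $uv$ and $|X\cap N_d[v]|\le 2$ for every vertex $v$. If no connected component of $G$ is a $K_4$ consisting entirely of c-edges, then $G$ has a 2-limited set $X$ with $|X|\ge |V(G)|/3$. -/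

import Mathlib

open scoped Graph

/-- The two kinds of edges: colour edges (c-edges) and domination edges (d-edges). -/
inductive EdgeKind : Type
  | c
  | d

namespace Graph

variable {α β : Type*}

/-- Every vertex of `G` is incident with at most three edges, of whatever kind and counted with
multiplicity. For a loopless multigraph this says that the maximum degree is at most `3`. -/
def MaxDegreeLeThree (G : Graph α β) : Prop :=
  ∀ v ∈ V(G), (G.incidenceSet v).encard ≤ 3

/-- The closed d-neighbourhood `N_d[v] = {v} ∪ {u : uv is a d-edge}`. -/
def closedDNbhd (G : Graph α β) (kind : β → EdgeKind) (v : α) : Set α :=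
  {v} ∪ {u | ∃ e, kind e = EdgeKind.d ∧ G.IsLink e u v}

/-- A set of vertices is 2-limited if it contains at most one end of each c-edge and at most two
elements of each closed d-neighbourhood. -/
structure IsTwoLimited (G : Graph α β) (kind : β → EdgeKind) (X : Set α) : Prop where
  subset : X ⊆ V(G)
  c_edge : ∀ e u v, kind e = EdgeKind.c → G.IsLink e u v → (X ∩ {u, v}).encard ≤ 1
  d_nbhd : ∀ v ∈ V(G), (X ∩ G.closedDNbhd kind v).encard ≤ 2

/-- `H` is a connected component of `G` which is a `K₄` all of whose edges are c-edges.
The relation `H ≤c G` says that `H` is a union of components of `G`; a complete graph on four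
vertices is connected, so `H` is then a single component. -/
structure IsCK4Component (H G : Graph α β) (kind : β → EdgeKind) : Prop where
  closed : H ≤c G
  four : V(H).encard = 4
  simple : H.Simple
  complete : ∀ x ∈ V(H), ∀ y ∈ V(H), x ≠ y → H.Adj x y
  all_c : ∀ e ∈ E(H), kind e = EdgeKind.c

end Graph

/-! The proof is by induction on the number of vertices, with the c-edges and d-edges recorded as
two simple graphs `C` and `D` on a finite set `S`. The inductive hypothesis asks that the two
degrees of each vertex add up to at most 3 and that `C` has no `K₄`; unlike a condition on
components, this passes to subsets of `S`.

If every d-edge is parallel to a c-edge, each vertex has at most one d-neighbour, so closed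
d-neighbourhoods have at most two elements. The largest class of a 3-colouring of `C` then works;
the colouring is Brooks' theorem for subcubic graphs, `exists_properOn_three`.

Otherwise some d-edge `uv` is not parallel to a c-edge. Choose `u` and `v`, and delete a set of at
most six vertices that contains their neighbours. A deleted d-neighbour of exactly one of `u`, `v`
may keep two d-neighbours, of which at most one may still be chosen; a new c-edge between these two
enforces this. At each of its ends the new c-edge takes the place of a deleted d-edge, so the degree
bound survives (`degree_le_sup_linkThrough`) and induction applies (`hasLarge_of_edge`), unless the
new edges create a `K₄` on a set `K`.

In that case (`hasLarge_of_clique`) the degree count is tight at every vertex of `K` (`links_at`):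
`K` is separated from the rest by the set `O` of its d-neighbours, each of which has two
d-neighbours in `K`, one in `{u, v}`, and no other edges. Now choose two vertices of `K` that are
not c-adjacent and up to two vertices of `O`, and delete `K`, `O` and one or both of `u`, `v`
(`hasLarge_of_gadget`). This adds no edges, so induction applies. -/

namespace SimpleGraph

section Subcubic

open scoped Classical

variable {V : Type*}

/-! ### Greedy extension of partial 3-colourings. -/

/-- The neighbours of `v` in the finset `S`. -/
noncomputable def nbrs (G : SimpleGraph V) (S : Finset V) (v : V) : Finset V :=
  {u ∈ S | G.Adj v u}

@[simp] lemma mem_nbrs {G : SimpleGraph V} {S : Finset V} {v u : V} :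
    u ∈ G.nbrs S v ↔ u ∈ S ∧ G.Adj v u := by
  simp [nbrs]

lemma nbrs_mono (G : SimpleGraph V) {S T : Finset V} (h : S ⊆ T) (v : V) :
    G.nbrs S v ⊆ G.nbrs T v := fun u hu => by
  simp only [mem_nbrs] at hu ⊢
  exact ⟨h hu.1, hu.2⟩

/-- `f` is a proper colouring of the subgraph of `G` induced on `U`. -/
def ProperOn {γ : Type*} (G : SimpleGraph V) (f : V → γ) (U : Finset V) : Prop :=
  ∀ x ∈ U, ∀ y ∈ U, G.Adj x y → f x ≠ f y

lemma ProperOn.update {γ : Type*} {G : SimpleGraph V} {f : V → γ} {U : Finset V}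
    (hf : G.ProperOn f U) {x : V} (hx : x ∉ U) {c : γ} (hc : ∀ u ∈ G.nbrs U x, f u ≠ c) :
    G.ProperOn (Function.update f x c) (insert x U) := by
  intro y hy z hz hyz
  have hne := hyz.ne
  rw [Finset.mem_insert] at hy hz
  rcases hy with rfl | hy <;> rcases hz with rfl | hz
  · exact absurd rfl hne
  · rw [Function.update_self, Function.update_of_ne hne.symm]
    exact (hc z (mem_nbrs.2 ⟨hz, hyz⟩)).symm
  · rw [Function.update_self, Function.update_of_ne hne]
    exact hc y (mem_nbrs.2 ⟨hy, hyz.symm⟩)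
  · rw [Function.update_of_ne (ne_of_mem_of_not_mem hy hx),
      Function.update_of_ne (ne_of_mem_of_not_mem hz hx)]
    exact hf y hy z hz hyz

lemma exists_color_of_card_image_le_two {f : V → Fin 3} {T : Finset V}
    (h : (T.image f).card ≤ 2) : ∃ c, ∀ u ∈ T, f u ≠ c := by
  obtain ⟨c, hc⟩ : ∃ c, c ∉ T.image f := by
    by_contra! hcon
    have : (Finset.univ : Finset (Fin 3)).card ≤ (T.image f).card :=
      Finset.card_le_card fun c _ => hcon c
    simp at this
    omega
  exact ⟨c, fun u hu hcu => hc (Finset.mem_image.2 ⟨u, hu, hcu⟩)⟩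

lemma ProperOn.exists_update {G : SimpleGraph V} {f : V → Fin 3} {U : Finset V}
    (hf : G.ProperOn f U) {x : V} (hx : x ∉ U) (hc : ((G.nbrs U x).image f).card ≤ 2) :
    ∃ c, G.ProperOn (Function.update f x c) (insert x U) := by
  obtain ⟨c, hc⟩ := exists_color_of_card_image_le_two hc
  exact ⟨c, hf.update hx hc⟩

/-- A partial proper 3-colouring of a subcubic graph extends along a path of uncoloured vertices,
up to the last vertex of the path. -/
lemma ProperOn.extend_path {G : SimpleGraph V} {S : Finset V}
    (hdeg : ∀ v ∈ S, (G.nbrs S v).card ≤ 3) {f : V → Fin 3} {U : Finset V} (hf : G.ProperOn f U)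
    (hUS : U ⊆ S) (w : ℕ → V) (k : ℕ) (hwS : ∀ i ≤ k, w i ∈ S) (hwU : ∀ i ≤ k, w i ∉ U)
    (hinj : ∀ i ≤ k, ∀ j ≤ k, w i = w j → i = j) (hadj : ∀ i < k, G.Adj (w i) (w (i + 1))) :
    ∃ g : V → Fin 3, (∀ x ∈ U, g x = f x) ∧
      G.ProperOn g (U ∪ (Finset.range k).image w) := by
  suffices H : ∀ m ≤ k, ∃ g : V → Fin 3, (∀ x ∈ U, g x = f x) ∧
      G.ProperOn g (U ∪ (Finset.range m).image w) from H k le_rfl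
  intro m
  induction m with
  | zero => exact fun _ => ⟨f, fun _ _ => rfl, by simpa using hf⟩
  | succ m ih =>
    intro hm
    obtain ⟨g, hgf, hg⟩ := ih (by omega)
    have hnot : ∀ j, m ≤ j → j ≤ k → w j ∉ U ∪ (Finset.range m).image w := by
      intro j hmj hjk
      simp only [Finset.mem_union, Finset.mem_image, Finset.mem_range, not_or, not_exists, not_and]
      refine ⟨hwU j hjk, fun i hi hij => ?_⟩
      have := hinj i (by omega) j hjk hij
      omega
    -- When `w m` is coloured, its successor on the path is still uncoloured, so at most two
    -- neighbours restrict its colour.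
    have hsub : G.nbrs (U ∪ (Finset.range m).image w) (w m) ⊆
        (G.nbrs S (w m)).erase (w (m + 1)) := by
      intro y hy
      rw [mem_nbrs] at hy
      refine Finset.mem_erase.2 ⟨fun h => hnot (m + 1) (by omega) hm (h ▸ hy.1), mem_nbrs.2 ⟨?_, hy.2⟩⟩
      rcases Finset.mem_union.1 hy.1 with h | h
      · exact hUS h
      · obtain ⟨i, hi, rfl⟩ := Finset.mem_image.1 h
        exact hwS i (by rw [Finset.mem_range] at hi; omega)
    have hcard := Finset.card_le_card hsub
    rw [Finset.card_erase_of_mem (mem_nbrs.2 ⟨hwS _ hm, hadj m hm⟩)] at hcard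
    have h3 := hdeg (w m) (hwS m (by omega))
    have himg := Finset.card_image_le (s := G.nbrs (U ∪ (Finset.range m).image w) (w m)) (f := g)
    obtain ⟨c, hc⟩ := hg.exists_update (hnot m le_rfl (by omega)) (by omega)
    refine ⟨Function.update g (w m) c, fun x hx => ?_, ?_⟩
    · rw [Function.update_of_ne (ne_of_mem_of_not_mem hx (hwU m (by omega))), hgf x hx]
    · rwa [Finset.range_add_one, Finset.image_insert, Finset.union_insert]

/-! ### Cycles and shortest cycles. -/

/-- The vertices `c 0, …, c (l - 1)` of `S` are distinct and form a cycle of `G` in this order. -/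
structure IsCycleOn (G : SimpleGraph V) (S : Finset V) (l : ℕ) (c : ℕ → V) : Prop where
  three_le : 3 ≤ l
  mem : ∀ i < l, c i ∈ S
  inj : ∀ i < l, ∀ j < l, c i = c j → i = j
  adj : ∀ i, i + 1 < l → G.Adj (c i) (c (i + 1))
  adj_last : G.Adj (c (l - 1)) (c 0)

lemma IsCycleOn.rotate {G : SimpleGraph V} {S : Finset V} {l : ℕ} {c : ℕ → V}
    (h : G.IsCycleOn S l c) {i : ℕ} (hi : i < l) :
    G.IsCycleOn S l (fun j => if i + j < l then c (i + j) else c (i + j - l)) where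
  three_le := h.three_le
  mem j hj := by
    split_ifs
    · exact h.mem _ (by omega)
    · exact h.mem _ (by omega)
  inj j hj k hk hjk := by
    split_ifs at hjk with h1 h2 h2
    · have := h.inj _ (by omega) _ (by omega) hjk
      omega
    · have := h.inj _ (by omega) _ (by omega) hjk
      omega
    · have := h.inj _ (by omega) _ (by omega) hjk
      omega
    · have := h.inj _ (by omega) _ (by omega) hjk
      omega
  adj j hj := by
    split_ifs with h1 h2 h2
    · exact h.adj _ (by omega)
    · have e1 : i + j = l - 1 := by omega
      have e2 : i + (j + 1) - l = 0 := by omega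
      rw [e1, e2]
      exact h.adj_last
    · omega
    · have e2 : i + (j + 1) - l = i + j - l + 1 := by omega
      rw [e2]
      exact h.adj _ (by omega)
  adj_last := by
    have h3 := h.three_le
    rcases Nat.eq_zero_or_pos i with rfl | hpos
    · rw [if_pos (by omega), if_pos (by omega)]
      simpa using h.adj_last
    · rw [if_neg (by omega), if_pos (by omega)]
      have e : i + 0 = i + (l - 1) - l + 1 := by omega
      rw [e]
      exact h.adj _ (by omega)

/-- All neighbours of the end of a path that cannot be prolonged lie on the path; one that is not
the predecessor of the end closes a cycle. -/
lemma exists_isCycleOn {G : SimpleGraph V} {S : Finset V} (hne : S.Nonempty)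
    (hdeg : ∀ v ∈ S, 2 ≤ (G.nbrs S v).card) : ∃ l c, G.IsCycleOn S l c := by
  let P : ℕ → Prop := fun k => ∃ c : ℕ → V, (∀ i ≤ k, c i ∈ S) ∧
    (∀ i ≤ k, ∀ j ≤ k, c i = c j → i = j) ∧ ∀ i < k, G.Adj (c i) (c (i + 1))
  have hbound : ∀ k, P k → k ≤ S.card := by
    rintro k ⟨c, hcS, hinj, -⟩
    have h1 : ((Finset.range (k + 1)).image c).card = k + 1 := by
      rw [Finset.card_image_of_injOn, Finset.card_range]
      intro i hi j hj hij
      simp only [Finset.coe_range, Set.mem_Iio] at hi hj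
      exact hinj i (by omega) j (by omega) hij
    have h2 : (Finset.range (k + 1)).image c ⊆ S := by
      intro x hx
      obtain ⟨i, hi, rfl⟩ := Finset.mem_image.1 hx
      exact hcS i (by rw [Finset.mem_range] at hi; omega)
    have := Finset.card_le_card h2
    omega
  have h0 : P 0 := by
    obtain ⟨x, hx⟩ := hne
    exact ⟨fun _ => x, fun _ _ => hx, fun i hi j hj _ => by omega, fun i hi => by omega⟩
  obtain ⟨k, hk, hmax⟩ : ∃ k, P k ∧ ¬ P (k + 1) := by
    by_contra! hcon
    have hall : ∀ k, P k := fun k => by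
      induction k with
      | zero => exact h0
      | succ k ih => exact hcon k ih
    have := hbound _ (hall (S.card + 1))
    omega
  obtain ⟨c, hcS, hinj, hadj⟩ := hk
  have hon : ∀ y ∈ G.nbrs S (c k), ∃ j ≤ k, c j = y := by
    intro y hy
    rw [mem_nbrs] at hy
    by_contra! hcon
    apply hmax
    refine ⟨fun i => if i ≤ k then c i else y, fun i hi => ?_, fun i hi j hj hij => ?_,
      fun i hi => ?_⟩
    · dsimp only
      split_ifs with h
      · exact hcS i h
      · exact hy.1
    · dsimp only at hij
      split_ifs at hij with h1 h2 h2
      · exact hinj i h1 j h2 hij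
      · exact absurd hij (hcon i h1)
      · exact absurd hij.symm (hcon j h2)
      · omega
    · dsimp only
      rw [if_pos (by omega)]
      split_ifs with h
      · exact hadj i (by omega)
      · have : i = k := by omega
        rw [this]
        exact hy.2
  -- For `k = 0` the truncated `c (k - 1)` is `c k` itself, which does no harm: then `hon` forces `j
  -- = k`, which is excluded below.
  obtain ⟨y, hy, hyne⟩ : ∃ y ∈ G.nbrs S (c k), y ≠ c (k - 1) :=
    Finset.exists_mem_ne (hdeg (c k) (hcS k le_rfl)) _
  obtain ⟨j, hjk, rfl⟩ := hon y hy
  rw [mem_nbrs] at hy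
  have hj1 : j ≠ k := by
    rintro rfl
    exact hy.2.ne rfl
  have hj2 : j ≠ k - 1 := by
    rintro rfl
    exact hyne rfl
  refine ⟨k - j + 1, fun i => c (j + i), ⟨by omega, fun i hi => hcS _ (by omega),
    fun a ha b hb hab => ?_, fun i hi => hadj _ (by omega), ?_⟩⟩
  · have := hinj _ (by omega) _ (by omega) hab
    omega
  · have e : j + (k - j + 1 - 1) = k := by omega
    rw [e]
    exact hy.2

/-- A chord would cut off a shorter cycle, of length `j - i + 1`. -/
lemma IsCycleOn.chordless {G : SimpleGraph V} {S : Finset V} {l : ℕ} {c : ℕ → V}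
    (h : G.IsCycleOn S l c) (hmin : ∀ m c', G.IsCycleOn S m c' → l ≤ m) {i j : ℕ} (hij : i < j)
    (hj : j < l) (hadj : G.Adj (c i) (c j)) : j = i + 1 ∨ i = 0 ∧ j = l - 1 := by
  by_contra! hcon
  have hne := hcon.1
  have hcyc : G.IsCycleOn S (j - i + 1) (fun k => c (i + k)) := by
    refine ⟨by omega, fun k hk => h.mem _ (by omega), fun a ha b hb hab => ?_,
      fun k hk => h.adj _ (by omega), ?_⟩
    · have := h.inj _ (by omega) _ (by omega) hab
      omega
    · have e : i + (j - i + 1 - 1) = j := by omega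
      rw [e]
      exact hadj.symm
  have := hmin _ _ hcyc
  have h2 := hcon.2
  omega

/-! ### Brooks' theorem for subcubic graphs. -/

lemma IsNClique.four_of_adj {G : SimpleGraph V} {a b c d : V} (hab : G.Adj a b) (hac : G.Adj a c)
    (had : G.Adj a d) (hbc : G.Adj b c) (hbd : G.Adj b d) (hcd : G.Adj c d) :
    G.IsNClique 4 {a, b, c, d} := by
  rw [isNClique_iff]
  refine ⟨?_, by simp [hab.ne, hac.ne, had.ne, hbc.ne, hbd.ne, hcd.ne]⟩
  simp [isClique_insert, hab, hac, had, hbc, hbd, hcd]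

lemma eq_or_eq_or_eq_of_adj {G : SimpleGraph V} {S : Finset V} {x a b c z : V}
    (hdeg : (G.nbrs S x).card ≤ 3) (ha : a ∈ S) (hb : b ∈ S) (hc : c ∈ S) (hz : z ∈ S)
    (hxa : G.Adj x a) (hxb : G.Adj x b) (hxc : G.Adj x c) (hxz : G.Adj x z)
    (hab : a ≠ b) (hac : a ≠ c) (hbc : b ≠ c) : z = a ∨ z = b ∨ z = c := by
  by_contra! hcon
  have hsub : ({z, a, b, c} : Finset V) ⊆ G.nbrs S x := by
    intro w hw
    simp only [Finset.mem_insert, Finset.mem_singleton] at hw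
    rw [mem_nbrs]
    rcases hw with rfl | rfl | rfl | rfl
    exacts [⟨hz, hxz⟩, ⟨ha, hxa⟩, ⟨hb, hxb⟩, ⟨hc, hxc⟩]
  have h4 : ({z, a, b, c} : Finset V).card = 4 := by
    simp [hcon.1, hcon.2.1, hcon.2.2, hab, hac, hbc]
  have := Finset.card_le_card hsub
  omega

/-- Each of `a`, `b` has at most one neighbour outside the diamond, so some colour is free for both.
With `a` and `b` coloured alike, `p` and then `q` see at most two colours. -/
lemma ProperOn.extend_diamond {G : SimpleGraph V} {S : Finset V}
    (hdeg : ∀ v ∈ S, (G.nbrs S v).card ≤ 3) {a b p q : V} (ha : a ∈ S) (hb : b ∈ S) (hp : p ∈ S)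
    (hq : q ∈ S) (hab : a ≠ b) (hnab : ¬ G.Adj a b) (hap : G.Adj a p) (haq : G.Adj a q)
    (hbp : G.Adj b p) (hbq : G.Adj b q) (hpq : G.Adj p q) {f : V → Fin 3}
    (hf : G.ProperOn f (S \ {a, b, p, q})) : ∃ g : V → Fin 3, G.ProperOn g S := by
  set U := S \ {a, b, p, q} with hU
  have hUm : ∀ x, x ∈ U ↔ x ∈ S ∧ x ≠ a ∧ x ≠ b ∧ x ≠ p ∧ x ≠ q := by
    intro x; simp [hU]
  have hone : ∀ x ∈ S, G.Adj x p → G.Adj x q → (G.nbrs U x).card ≤ 1 := by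
    intro x hx h1 h2
    have hsub : G.nbrs U x ⊆ ((G.nbrs S x).erase p).erase q := by
      intro y hy
      rw [mem_nbrs, hUm] at hy
      simp only [Finset.mem_erase, mem_nbrs]
      exact ⟨hy.1.2.2.2.2, hy.1.2.2.2.1, hy.1.1, hy.2⟩
    have := Finset.card_le_card hsub
    rw [Finset.card_erase_of_mem, Finset.card_erase_of_mem] at this
    · have := hdeg x hx
      omega
    · exact mem_nbrs.2 ⟨hp, h1⟩
    · exact Finset.mem_erase.2 ⟨hpq.ne.symm, mem_nbrs.2 ⟨hq, h2⟩⟩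
  obtain ⟨c, hc⟩ : ∃ c, ∀ u ∈ G.nbrs U a ∪ G.nbrs U b, f u ≠ c := by
    apply exists_color_of_card_image_le_two
    refine Finset.card_image_le.trans ((Finset.card_union_le _ _).trans ?_)
    have := hone a ha hap haq
    have := hone b hb hbp hbq
    omega
  have haU : a ∉ U := by simp [hUm]
  have hbU : b ∉ U := by simp [hUm]
  have hpU : p ∉ U := by simp [hUm]
  have hqU : q ∉ U := by simp [hUm]
  have h1 := hf.update haU (c := c) fun u hu => hc u (Finset.mem_union_left _ hu)
  have h2 : G.ProperOn (Function.update (Function.update f a c) b c) (insert b (insert a U)) := by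
    apply h1.update (by simp [hab.symm, hbU])
    intro u hu
    rw [mem_nbrs, Finset.mem_insert] at hu
    rcases hu.1 with rfl | h
    · exact absurd hu.2.symm hnab
    · rw [Function.update_of_ne (ne_of_mem_of_not_mem h haU)]
      exact hc u (Finset.mem_union_right _ (mem_nbrs.2 ⟨h, hu.2⟩))
  set g := Function.update (Function.update f a c) b c with hg
  have hga : g a = c := by rw [hg, Function.update_of_ne hab, Function.update_self]
  have hgb : g b = c := by rw [hg, Function.update_self]
  have hnbr : ∀ x y, x ∈ S → y ∈ S → G.Adj x a → G.Adj x b → G.Adj x y → y ≠ a → y ≠ b →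
      ∀ z ∈ S, G.Adj x z → z = a ∨ z = b ∨ z = y := by
    intro x y hx hy hxa hxb hxy hya hyb z hz hxz
    exact eq_or_eq_or_eq_of_adj (hdeg x hx) ha hb hy hz hxa hxb hxy hxz hab hya.symm hyb.symm
  obtain ⟨c1, h3⟩ := h2.exists_update (x := p) (by simp [hap.ne.symm, hbp.ne.symm, hpU]) (by
    have : (G.nbrs (insert b (insert a U)) p).image g ⊆ {c} := by
      intro k hk
      obtain ⟨z, hz, rfl⟩ := Finset.mem_image.1 hk
      rw [mem_nbrs, Finset.mem_insert, Finset.mem_insert, hUm] at hz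
      rcases hz.1 with rfl | rfl | h
      · simp [hgb]
      · simp [hga]
      · rcases hnbr p q hp hq hap.symm hbp.symm hpq haq.ne.symm hbq.ne.symm z h.1 hz.2 with
          rfl | rfl | rfl <;> simp at h
    exact (Finset.card_le_card this).trans (by simp))
  obtain ⟨c2, h4⟩ := h3.exists_update (x := q)
      (by simp [haq.ne.symm, hbq.ne.symm, hqU, hpq.ne.symm]) (by
    have : (G.nbrs (insert p (insert b (insert a U))) q).image (Function.update g p c1) ⊆
        {c, c1} := by
      intro k hk
      obtain ⟨z, hz, rfl⟩ := Finset.mem_image.1 hk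
      rw [mem_nbrs, Finset.mem_insert, Finset.mem_insert, Finset.mem_insert, hUm] at hz
      rcases hz.1 with rfl | rfl | rfl | h
      · simp
      · rw [Function.update_of_ne hbp.ne]; simp [hgb]
      · rw [Function.update_of_ne hap.ne]; simp [hga]
      · rcases hnbr q p hq hp haq.symm hbq.symm hpq.symm hap.ne.symm hbp.ne.symm z h.1 hz.2 with
          rfl | rfl | rfl <;> simp at h
    exact (Finset.card_le_card this).trans Finset.card_le_two)
  refine ⟨_, fun x hx y hy => h4 x ?_ y ?_⟩
  · simp only [Finset.mem_insert, hUm]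
    tauto
  · simp only [Finset.mem_insert, hUm]
    tauto

/-- A 3-colouring exists if the cycle `c` is chordless, every vertex of it has degree three,
and the outer neighbours `x` of `c (l - 1)` and `y` of `c 0` are coloured differently. -/
lemma ProperOn.extend_cycle {G : SimpleGraph V} {S : Finset V}
    (hdeg : ∀ v ∈ S, (G.nbrs S v).card ≤ 3) {l : ℕ} {c : ℕ → V} (hc : G.IsCycleOn S l c)
    {x y : V} (hy : G.nbrs (S \ (Finset.range l).image c) (c 0) ⊆ {y})
    (hxS : x ∈ S) (hx : x ∉ (Finset.range l).image c) (hxadj : G.Adj (c (l - 1)) x)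
    {f : V → Fin 3} (hf : G.ProperOn f (S \ (Finset.range l).image c)) (hxy : f x ≠ f y) :
    ∃ g : V → Fin 3, G.ProperOn g S := by
  have h3 := hc.three_le
  set U := S \ (Finset.range l).image c with hU
  have hcU : ∀ i < l, c i ∉ U := fun i hi h =>
    (Finset.mem_sdiff.1 h).2 (Finset.mem_image_of_mem _ (Finset.mem_range.2 hi))
  have hxU : x ∈ U := Finset.mem_sdiff.2 ⟨hxS, hx⟩
  -- Giving `c 0` the colour of `x` makes two neighbours of `c (l - 1)` agree, so a colour remains
  -- for that last vertex once the path between has been coloured.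
  have h1 := hf.update (hcU 0 (by omega)) (c := f x) (by
    intro u hu
    rw [Finset.mem_singleton.1 (hy hu)]
    exact hxy.symm)
  obtain ⟨g, hgf, hg⟩ := h1.extend_path hdeg
    (Finset.insert_subset (hc.mem 0 (by omega)) Finset.sdiff_subset) (fun i => c (i + 1)) (l - 2)
    (fun i hi => hc.mem _ (by omega))
    (fun i hi h => by
      rcases Finset.mem_insert.1 h with h | h
      · have := hc.inj _ (by omega) _ (by omega) h
        omega
      · exact hcU _ (by omega) h)
    (fun i hi j hj hij => by
      have := hc.inj _ (by omega) _ (by omega) hij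
      omega)
    (fun i hi => hc.adj _ (by omega))
  set U' := insert (c 0) U ∪ (Finset.range (l - 2)).image (fun i => c (i + 1)) with hU'
  have hS : S ⊆ insert (c (l - 1)) U' := by
    intro z hz
    by_cases hzc : z ∈ (Finset.range l).image c
    · obtain ⟨i, hi, rfl⟩ := Finset.mem_image.1 hzc
      rw [Finset.mem_range] at hi
      rcases Nat.eq_zero_or_pos i with rfl | hpos
      · simp [hU']
      · rcases Nat.lt_or_ge i (l - 1) with h | h
        · refine Finset.mem_insert_of_mem (Finset.mem_union_right _ (Finset.mem_image.2
            ⟨i - 1, Finset.mem_range.2 (by omega), ?_⟩))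
          congr 1
          omega
        · have : i = l - 1 := by omega
          rw [this]
          exact Finset.mem_insert_self _ _
    · exact Finset.mem_insert_of_mem (Finset.mem_union_left _ (Finset.mem_insert_of_mem
        (Finset.mem_sdiff.2 ⟨hz, hzc⟩)))
  have hU'S : U' ⊆ S := by
    apply Finset.union_subset
      (Finset.insert_subset (hc.mem 0 (by omega)) Finset.sdiff_subset)
    intro z hz
    obtain ⟨i, hi, rfl⟩ := Finset.mem_image.1 hz
    exact hc.mem _ (by rw [Finset.mem_range] at hi; omega)
  have hlast : c (l - 1) ∉ U' := by
    intro h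
    rcases Finset.mem_union.1 h with h | h
    · rcases Finset.mem_insert.1 h with h | h
      · have := hc.inj _ (by omega) _ (by omega) h
        omega
      · exact hcU _ (by omega) h
    · obtain ⟨i, hi, hi'⟩ := Finset.mem_image.1 h
      rw [Finset.mem_range] at hi
      have := hc.inj _ (by omega) _ (by omega) hi'
      omega
  have hc0x : c 0 ≠ x := fun h => hcU 0 (by omega) (h ▸ hxU)
  have hgx : g x = f x := by
    rw [hgf x (Finset.mem_insert_of_mem hxU), Function.update_of_ne hc0x.symm]
  have hg0 : g (c 0) = f x := by
    rw [hgf _ (Finset.mem_insert_self _ _), Function.update_self]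
  obtain ⟨k, hk⟩ := hg.exists_update hlast (by
    have hsub : (G.nbrs U' (c (l - 1))).image g ⊆
        ((G.nbrs S (c (l - 1))).erase (c 0)).image g := by
      intro k hk
      obtain ⟨z, hz, rfl⟩ := Finset.mem_image.1 hk
      rw [mem_nbrs] at hz
      by_cases hz0 : z = c 0
      · refine Finset.mem_image.2 ⟨x, Finset.mem_erase.2 ⟨hc0x.symm, mem_nbrs.2 ⟨hxS, hxadj⟩⟩, ?_⟩
        rw [hz0, hgx, hg0]
      · exact Finset.mem_image_of_mem _ (Finset.mem_erase.2 ⟨hz0, mem_nbrs.2 ⟨hU'S hz.1, hz.2⟩⟩)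
    refine (Finset.card_le_card hsub).trans (Finset.card_image_le.trans ?_)
    rw [Finset.card_erase_of_mem (mem_nbrs.2 ⟨hc.mem 0 (by omega), hc.adj_last⟩)]
    have := hdeg _ (hc.mem (l - 1) (by omega))
    omega)
  exact ⟨_, fun a ha b hb => hk a (hS ha) b (hS hb)⟩

lemma exists_minimal_cycleOn {G : SimpleGraph V} {S : Finset V} (hne : S.Nonempty)
    (hdeg : ∀ v ∈ S, 2 ≤ (G.nbrs S v).card) :
    ∃ l c, G.IsCycleOn S l c ∧ ∀ m c', G.IsCycleOn S m c' → l ≤ m := by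
  have hex : ∃ l, ∃ c, G.IsCycleOn S l c := exists_isCycleOn hne hdeg
  obtain ⟨c, hc⟩ := Nat.find_spec hex
  exact ⟨Nat.find hex, c, hc, fun m c' h => Nat.find_min' hex ⟨c', h⟩⟩

/-- In a cubic graph every vertex of a shortest cycle has exactly one neighbour off the cycle. -/
lemma IsCycleOn.exists_outer {G : SimpleGraph V} {S : Finset V} {l : ℕ} {c : ℕ → V}
    (hc : G.IsCycleOn S l c) (hmin : ∀ m c', G.IsCycleOn S m c' → l ≤ m)
    (hdeg : ∀ v ∈ S, (G.nbrs S v).card = 3) {i : ℕ} (hi : i < l) :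
    ∃ x, G.nbrs (S \ (Finset.range l).image c) (c i) = {x} := by
  have h3 := hc.three_le
  obtain ⟨a, b, ha, hb, hab, hia, hib, hall⟩ : ∃ a b, a < l ∧ b < l ∧ a ≠ b ∧ G.Adj (c i) (c a) ∧
      G.Adj (c i) (c b) ∧ ∀ j < l, G.Adj (c i) (c j) → j = a ∨ j = b := by
    have hch : ∀ j < l, G.Adj (c i) (c j) →
        (j = i + 1 ∨ i = 0 ∧ j = l - 1) ∨ (i = j + 1 ∨ j = 0 ∧ i = l - 1) := by
      intro j hj hij
      rcases lt_trichotomy i j with h | rfl | h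
      · exact Or.inl (hc.chordless hmin h hj hij)
      · exact absurd rfl hij.ne
      · exact Or.inr (hc.chordless hmin h hi hij.symm)
    by_cases h0 : i = 0
    · subst h0
      refine ⟨1, l - 1, by omega, by omega, by omega, hc.adj 0 (by omega), hc.adj_last.symm, ?_⟩
      intro j hj hij
      have := hch j hj hij
      omega
    · have hpred : G.Adj (c i) (c (i - 1)) := by
        have := hc.adj (i - 1) (by omega)
        rw [Nat.sub_add_cancel (by omega)] at this
        exact this.symm
      by_cases h1 : i = l - 1
      · refine ⟨i - 1, 0, by omega, by omega, by omega, hpred, h1 ▸ hc.adj_last, ?_⟩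
        intro j hj hij
        have := hch j hj hij
        omega
      · refine ⟨i - 1, i + 1, by omega, by omega, by omega, hpred, hc.adj i (by omega), ?_⟩
        intro j hj hij
        have := hch j hj hij
        omega
  have heq : G.nbrs (S \ (Finset.range l).image c) (c i) = ((G.nbrs S (c i)).erase (c a)).erase (c b) := by
    ext z
    simp only [mem_nbrs, Finset.mem_sdiff, Finset.mem_erase, Finset.mem_image, Finset.mem_range,
      not_exists, not_and]
    constructor
    · rintro ⟨⟨hz, hzc⟩, hiz⟩
      exact ⟨fun h => hzc b hb h.symm, fun h => hzc a ha h.symm, hz, hiz⟩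
    · rintro ⟨hzb, hza, hz, hiz⟩
      refine ⟨⟨hz, ?_⟩, hiz⟩
      rintro j hj rfl
      rcases hall j hj hiz with rfl | rfl
      exacts [hza rfl, hzb rfl]
  rw [← Finset.card_eq_one, heq, Finset.card_erase_of_mem, Finset.card_erase_of_mem,
    hdeg _ (hc.mem i hi)]
  · exact mem_nbrs.2 ⟨hc.mem a ha, hia⟩
  · exact Finset.mem_erase.2 ⟨fun h => hab (hc.inj _ hb _ ha h).symm, mem_nbrs.2 ⟨hc.mem b hb, hib⟩⟩

/-- In a cubic graph without `K₄`, a shortest cycle can be numbered such that the outer neighbours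
of its last and its first vertex differ. -/
lemma exists_cycleOn_outer_ne {G : SimpleGraph V} {S : Finset V} (hne : S.Nonempty)
    (hdeg : ∀ v ∈ S, (G.nbrs S v).card = 3) (hK : ∀ K ⊆ S, ¬ G.IsNClique 4 K) :
    ∃ l c x y, G.IsCycleOn S l c ∧ x ≠ y ∧
      G.nbrs (S \ (Finset.range l).image c) (c (l - 1)) = {x} ∧
      G.nbrs (S \ (Finset.range l).image c) (c 0) = {y} := by
  obtain ⟨l, c, hc, hmin⟩ := exists_minimal_cycleOn (G := G) hne
    (fun v hv => by rw [hdeg v hv]; norm_num)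
  have h3 := hc.three_le
  choose o ho using fun (i : ℕ) (hi : i < l) => hc.exists_outer hmin hdeg hi
  have hmem : ∀ i (hi : i < l), o i hi ∈ S ∧ o i hi ∉ (Finset.range l).image c ∧
      G.Adj (c i) (o i hi) := by
    intro i hi
    have : o i hi ∈ G.nbrs (S \ (Finset.range l).image c) (c i) := by
      rw [ho]; exact Finset.mem_singleton_self _
    rw [mem_nbrs, Finset.mem_sdiff] at this
    exact ⟨this.1.1, this.1.2, this.2⟩
  obtain ⟨i, hi, hne⟩ : ∃ i, ∃ hi : i + 1 < l, o i (by omega) ≠ o (i + 1) hi := by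
    -- If all outer neighbours coincide, this common vertex is adjacent to the whole cycle; its
    -- degree forces a triangle, and together they form a `K₄`.
    by_contra! hcon
    have hall : ∀ i (hi : i < l), o i hi = o 0 (by omega) := by
      intro i
      induction i with
      | zero => exact fun _ => rfl
      | succ i ih => exact fun hi => (hcon i hi).symm.trans (ih (by omega))
    have hadj : ∀ i < l, G.Adj (o 0 (by omega)) (c i) := fun i hi =>
      (hall i hi) ▸ (hmem i hi).2.2.symm
    have hle : l = 3 := by
      have hsub : (Finset.range l).image c ⊆ G.nbrs S (o 0 (by omega)) := by
        intro z hz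
        obtain ⟨i, hi, rfl⟩ := Finset.mem_image.1 hz
        rw [Finset.mem_range] at hi
        exact mem_nbrs.2 ⟨hc.mem i hi, hadj i hi⟩
      have := Finset.card_le_card hsub
      rw [hdeg _ (hmem 0 (by omega)).1, Finset.card_image_of_injOn, Finset.card_range] at this
      · omega
      · intro i hi j hj hij
        simp only [Finset.coe_range, Set.mem_Iio] at hi hj
        exact hc.inj i hi j hj hij
    subst hle
    refine hK {o 0 (by omega), c 0, c 1, c 2} ?_ (IsNClique.four_of_adj (hadj 0 (by omega))
      (hadj 1 (by omega)) (hadj 2 (by omega)) (hc.adj 0 (by omega)) hc.adj_last.symm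
      (hc.adj 1 (by omega)))
    intro z hz
    simp only [Finset.mem_insert, Finset.mem_singleton] at hz
    rcases hz with rfl | rfl | rfl | rfl
    exacts [(hmem 0 (by omega)).1, hc.mem 0 (by omega), hc.mem 1 (by omega), hc.mem 2 (by omega)]
  have himg : (Finset.range l).image (fun j => if i + 1 + j < l then c (i + 1 + j)
      else c (i + 1 + j - l)) = (Finset.range l).image c := by
    apply Finset.eq_of_subset_of_card_le
    · intro z hz
      obtain ⟨j, hj, rfl⟩ := Finset.mem_image.1 hz
      rw [Finset.mem_range] at hj
      split_ifs with h
      · exact Finset.mem_image_of_mem _ (Finset.mem_range.2 h)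
      · exact Finset.mem_image_of_mem _ (Finset.mem_range.2 (by omega))
    · refine Finset.card_image_le.trans_eq (Finset.card_image_of_injOn ?_).symm
      intro a ha b hb hab
      simp only [Finset.coe_range, Set.mem_Iio] at ha hb
      exact (hc.rotate hi).inj a ha b hb hab
  -- Rotation by `i + 1` makes `c (i + 1)` the first vertex and `c i` the last.
  refine ⟨l, _, o i (by omega), o (i + 1) hi, hc.rotate hi, hne, ?_, ?_⟩
  · rw [himg, if_neg (by omega)]
    have e : i + 1 + (l - 1) - l = i := by omega
    rw [e, ho]
  · rw [himg, if_pos (by omega)]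
    exact ho (i + 1) hi

lemma nbrs_sup_edge_card_le {G : SimpleGraph V} {S T : Finset V}
    (hdeg : ∀ v ∈ S, (G.nbrs S v).card ≤ 3) (hTS : T ⊆ S) {x y : V}
    (hx : (G.nbrs T x).card ≤ 2) (hy : (G.nbrs T y).card ≤ 2) :
    ∀ v ∈ T, ((G ⊔ edge x y).nbrs T v).card ≤ 3 := by
  intro v hv
  have hnew : ∀ z ∈ (G ⊔ edge x y).nbrs T v,
      z ∈ G.nbrs T v ∨ v = x ∧ z = y ∨ v = y ∧ z = x := by
    intro z hz
    rw [mem_nbrs, sup_adj, edge_adj] at hz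
    rcases hz.2 with h | h
    · exact Or.inl (mem_nbrs.2 ⟨hz.1, h⟩)
    · exact Or.inr h.1
  by_cases hvx : v = x
  · have hsub : (G ⊔ edge x y).nbrs T v ⊆ insert y (G.nbrs T x) := by
      intro z hz
      rcases hnew z hz with h | h | h
      · exact Finset.mem_insert_of_mem (hvx ▸ h)
      · exact h.2 ▸ Finset.mem_insert_self _ _
      · rw [h.2, ← hvx, h.1]
        exact Finset.mem_insert_self _ _
    have := Finset.card_le_card hsub
    have := Finset.card_insert_le y (G.nbrs T x)
    omega
  by_cases hvy : v = y
  · have hsub : (G ⊔ edge x y).nbrs T v ⊆ insert x (G.nbrs T y) := by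
      intro z hz
      rcases hnew z hz with h | h | h
      · exact Finset.mem_insert_of_mem (hvy ▸ h)
      · exact absurd h.1 hvx
      · exact h.2 ▸ Finset.mem_insert_self _ _
    have := Finset.card_le_card hsub
    have := Finset.card_insert_le x (G.nbrs T y)
    omega
  · have hsub : (G ⊔ edge x y).nbrs T v ⊆ G.nbrs S v := by
      intro z hz
      rcases hnew z hz with h | h | h
      · exact nbrs_mono G hTS v h
      · exact absurd h.1 hvx
      · exact absurd h.1 hvy
    exact (Finset.card_le_card hsub).trans (hdeg v (hTS hv))

/-- A subcubic graph without `K₄` is 3-colourable. -/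
theorem exists_properOn_three {G : SimpleGraph V} (S : Finset V)
    (hdeg : ∀ v ∈ S, (G.nbrs S v).card ≤ 3) (hK : ∀ K ⊆ S, ¬ G.IsNClique 4 K) :
    ∃ f : V → Fin 3, G.ProperOn f S := by
  -- The graph varies in the induction because an edge is added to it below.
  induction h : S.card using Nat.strong_induction_on generalizing G S with
  | _ n ih =>
  rcases S.eq_empty_or_nonempty with rfl | hne
  · exact ⟨fun _ => 0, fun x hx => by simp at hx⟩
  have hsub : ∀ T ⊂ S, ∃ f : V → Fin 3, G.ProperOn f T := fun T hT =>
    ih T.card (h ▸ Finset.card_lt_card hT) T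
      (fun v hv => (Finset.card_le_card (nbrs_mono G hT.1 v)).trans (hdeg v (hT.1 hv)))
      (fun K hKT => hK K (hKT.trans hT.1)) rfl
  by_cases hlow : ∃ v ∈ S, (G.nbrs S v).card ≤ 2
  · obtain ⟨v, hv, hv2⟩ := hlow
    obtain ⟨f, hf⟩ := hsub _ (Finset.erase_ssubset hv)
    obtain ⟨c, hc⟩ := hf.exists_update (Finset.notMem_erase v S)
      (Finset.card_image_le.trans
        ((Finset.card_le_card (nbrs_mono G (Finset.erase_subset v S) v)).trans hv2))
    rw [Finset.insert_erase hv] at hc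
    exact ⟨_, hc⟩
  -- Diamonds are removed here so that adding the edge `xy` below cannot create a `K₄`.
  by_cases hdia : ∃ a ∈ S, ∃ b ∈ S, ∃ p ∈ S, ∃ q ∈ S, a ≠ b ∧ ¬ G.Adj a b ∧ G.Adj a p ∧
      G.Adj a q ∧ G.Adj b p ∧ G.Adj b q ∧ G.Adj p q
  · obtain ⟨a, ha, b, hb, p, hp, q, hq, hab, hnab, hap, haq, hbp, hbq, hpq⟩ := hdia
    obtain ⟨f, hf⟩ := hsub (S \ {a, b, p, q})
      ((Finset.ssubset_iff_of_subset Finset.sdiff_subset).2 ⟨a, ha, by simp⟩)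
    exact hf.extend_diamond hdeg ha hb hp hq hab hnab hap haq hbp hbq hpq
  have hcub : ∀ v ∈ S, (G.nbrs S v).card = 3 := by
    push Not at hlow
    intro v hv
    have := hdeg v hv
    have := hlow v hv
    omega
  obtain ⟨l, c, x, y, hc, hxy, hx, hy⟩ := exists_cycleOn_outer_ne hne hcub hK
  have h3 := hc.three_le
  set T := S \ (Finset.range l).image c with hT
  have hxm : x ∈ G.nbrs T (c (l - 1)) := hx ▸ Finset.mem_singleton_self _
  have hym : y ∈ G.nbrs T (c 0) := hy ▸ Finset.mem_singleton_self _
  rw [mem_nbrs] at hxm hym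
  have hTS : T ⊆ S := Finset.sdiff_subset
  have hcT : ∀ i < l, c i ∉ T := fun i hi h =>
    (Finset.mem_sdiff.1 h).2 (Finset.mem_image_of_mem _ (Finset.mem_range.2 hi))
  have hTss : T ⊂ S := (Finset.ssubset_iff_of_subset hTS).2
    ⟨c 0, hc.mem 0 (by omega), hcT 0 (by omega)⟩
  have htwo : ∀ i < l, ∀ z ∈ T, G.Adj (c i) z → (G.nbrs T z).card ≤ 2 := by
    intro i hi z hz hiz
    have : G.nbrs T z ⊆ (G.nbrs S z).erase (c i) := by
      intro w hw
      rw [mem_nbrs] at hw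
      exact Finset.mem_erase.2 ⟨ne_of_mem_of_not_mem hw.1 (hcT i hi), mem_nbrs.2 ⟨hTS hw.1, hw.2⟩⟩
    have := Finset.card_le_card this
    rw [Finset.card_erase_of_mem (mem_nbrs.2 ⟨hc.mem i hi, hiz.symm⟩), hcub z (hTS hz)] at this
    exact this
  -- Colouring `T` with the edge `xy` added forces different colours on `x` and `y`. A `K₄` using
  -- the new edge would be a diamond of `G` with `x`, `y` as its nonadjacent vertices.
  obtain ⟨f, hf, hfxy⟩ : ∃ f : V → Fin 3, G.ProperOn f T ∧ f x ≠ f y := by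
    by_cases hadj : G.Adj x y
    · obtain ⟨f, hf⟩ := hsub T hTss
      exact ⟨f, hf, hf x hxm.1 y hym.1 hadj⟩
    obtain ⟨f, hf⟩ := ih T.card (h ▸ Finset.card_lt_card hTss) (G := G ⊔ edge x y) T
      (nbrs_sup_edge_card_le hdeg hTS (htwo _ (by omega) x hxm.1 hxm.2)
        (htwo _ (by omega) y hym.1 hym.2)) (by
        intro K hKT hKc
        rw [isNClique_iff] at hKc
        have hnot : ∀ u ∈ K, ∀ v ∈ K, u ≠ v → ¬ (u = x ∧ v = y ∨ u = y ∧ v = x) → G.Adj u v := by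
          intro u hu v hv huv hne
          have := hKc.1 hu hv huv
          rw [sup_adj, edge_adj] at this
          tauto
        have hxK : x ∈ K := by
          by_contra hxK
          refine hK K (hKT.trans hTS) (isNClique_iff _ |>.2 ⟨fun u hu v hv huv => ?_, hKc.2⟩)
          refine hnot u hu v hv huv ?_
          rintro (⟨rfl, -⟩ | ⟨-, rfl⟩) <;> contradiction
        have hyK : y ∈ K := by
          by_contra hyK
          refine hK K (hKT.trans hTS) (isNClique_iff _ |>.2 ⟨fun u hu v hv huv => ?_, hKc.2⟩)
          refine hnot u hu v hv huv ?_
          rintro (⟨-, rfl⟩ | ⟨rfl, -⟩) <;> contradiction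
        have h2 : ((K.erase x).erase y).card = 2 := by
          rw [Finset.card_erase_of_mem (Finset.mem_erase.2 ⟨hxy.symm, hyK⟩),
            Finset.card_erase_of_mem hxK, hKc.2]
        obtain ⟨p, q, hpq, hpqeq⟩ := Finset.card_eq_two.1 h2
        have hp : p ∈ (K.erase x).erase y := by rw [hpqeq]; simp
        have hq : q ∈ (K.erase x).erase y := by rw [hpqeq]; simp
        simp only [Finset.mem_erase] at hp hq
        have hKS := hKT.trans hTS
        refine hdia ⟨x, hKS hxK, y, hKS hyK, p, hKS hp.2.2, q, hKS hq.2.2, hxy, hadj, ?_, ?_, ?_,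
          ?_, ?_⟩
        · exact hnot x hxK p hp.2.2 hp.2.1.symm (by tauto)
        · exact hnot x hxK q hq.2.2 hq.2.1.symm (by tauto)
        · exact hnot y hyK p hp.2.2 hp.1.symm (by tauto)
        · exact hnot y hyK q hq.2.2 hq.1.symm (by tauto)
        · exact hnot p hp.2.2 q hq.2.2 hpq (by tauto)) rfl
    refine ⟨f, fun u hu v hv huv => hf u hu v hv (Or.inl huv), hf x hxm.1 y hym.1 ?_⟩
    rw [sup_adj, edge_adj]
    exact Or.inr ⟨Or.inl ⟨rfl, rfl⟩, hxy⟩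
  exact hf.extend_cycle hdeg hc hy.subset (hTS hxm.1) (Finset.mem_sdiff.1 hxm.1).2 hxm.2 hfxy

/-! ### Local 2-limited sets and the general reduction. -/

/-- `X` is a 2-limited subset of `S`, where `C` and `D` are the graphs of c-edges and d-edges and
only the vertices in `S` are taken into account. -/
structure IsTwoLimitedOn (C D : SimpleGraph V) (S X : Finset V) : Prop where
  subset : X ⊆ S
  indep : ∀ x ∈ X, ∀ y ∈ X, ¬ C.Adj x y
  nbhd : ∀ v ∈ S, (X ∩ insert v (D.nbrs S v)).card ≤ 2

/-- The instance induced on `S` is subcubic and has no `K₄` of c-edges. -/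
structure IsAdmissibleOn (C D : SimpleGraph V) (S : Finset V) : Prop where
  degree_le : ∀ v ∈ S, (C.nbrs S v).card + (D.nbrs S v).card ≤ 3
  clique_free : ∀ K ⊆ S, ¬ C.IsNClique 4 K

/-- `S` has a 2-limited subset containing at least a third of its elements. -/
def HasLargeTwoLimited (C D : SimpleGraph V) (S : Finset V) : Prop :=
  ∃ X, IsTwoLimitedOn C D S X ∧ S.card ≤ 3 * X.card

lemma IsAdmissibleOn.mono {C D : SimpleGraph V} {S T : Finset V} (h : IsAdmissibleOn C D S)
    (hTS : T ⊆ S) : IsAdmissibleOn C D T where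
  degree_le v hv := (Nat.add_le_add (Finset.card_le_card (nbrs_mono C hTS v))
    (Finset.card_le_card (nbrs_mono D hTS v))).trans (h.degree_le v (hTS hv))
  clique_free K hK := h.clique_free K (hK.trans hTS)

lemma mem_of_nbrs_subset {G : SimpleGraph V} {S B : Finset V} {a b : V} (h : G.nbrs S a ⊆ B)
    (hb : b ∈ S) (hab : G.Adj a b) : b ∈ B := h (mem_nbrs.2 ⟨hb, hab⟩)

/-- Deleting `B` and choosing `A ⊆ B`, where the closed neighbourhood of `A` is contained in `B`,
reduces the problem on `S` to a problem on `S \ B`. -/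
lemma IsTwoLimitedOn.union {C C' D : SimpleGraph V} {S A B X : Finset V} (hAB : A ⊆ B)
    (hBS : B ⊆ S) (hX : IsTwoLimitedOn C' D (S \ B) X)
    (hCC' : ∀ x ∈ S \ B, ∀ y ∈ S \ B, C.Adj x y → C'.Adj x y)
    (hA : ∀ x ∈ A, ∀ y ∈ A, ¬ C.Adj x y)
    (hCA : ∀ a ∈ A, C.nbrs S a ⊆ B) (hDA : ∀ a ∈ A, D.nbrs S a ⊆ B)
    (hB : ∀ v ∈ B, (A ∩ insert v (D.nbrs S v)).card + (D.nbrs (S \ B) v).card ≤ 2 ∨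
      (A ∩ insert v (D.nbrs S v)).card ≤ 1 ∧
        ∀ x ∈ D.nbrs (S \ B) v, ∀ y ∈ D.nbrs (S \ B) v, x ≠ y → C'.Adj x y) :
    IsTwoLimitedOn C D S (X ∪ A) where
  subset := Finset.union_subset (hX.subset.trans Finset.sdiff_subset) (hAB.trans hBS)
  indep x hx y hy hxy := by
    rcases Finset.mem_union.1 hx with hx | hx <;> rcases Finset.mem_union.1 hy with hy | hy
    · exact hX.indep x hx y hy (hCC' x (hX.subset hx) y (hX.subset hy) hxy)
    · have hxS := Finset.mem_sdiff.1 (hX.subset hx)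
      exact hxS.2 (mem_of_nbrs_subset (hCA y hy) hxS.1 hxy.symm)
    · have hyS := Finset.mem_sdiff.1 (hX.subset hy)
      exact hyS.2 (mem_of_nbrs_subset (hCA x hx) hyS.1 hxy)
    · exact hA x hx y hy hxy
  nbhd v hv := by
    by_cases hvB : v ∈ B
    · have hsub : (X ∪ A) ∩ insert v (D.nbrs S v) ⊆
          (X ∩ D.nbrs (S \ B) v) ∪ (A ∩ insert v (D.nbrs S v)) := by
        intro z hz
        rw [Finset.mem_inter, Finset.mem_union] at hz
        rcases hz.1 with h | h
        · have hzS := Finset.mem_sdiff.1 (hX.subset h)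
          rcases Finset.mem_insert.1 hz.2 with rfl | h'
          · exact absurd hvB hzS.2
          · exact Finset.mem_union_left _ (Finset.mem_inter.2
              ⟨h, mem_nbrs.2 ⟨hX.subset h, (mem_nbrs.1 h').2⟩⟩)
        · exact Finset.mem_union_right _ (Finset.mem_inter.2 ⟨h, hz.2⟩)
      have h1 := (Finset.card_le_card hsub).trans (Finset.card_union_le _ _)
      -- In the second alternative the remaining d-neighbours of `v` form a clique of `C'`, so `X`
      -- contains at most one of them.
      rcases hB v hvB with h | ⟨h, h'⟩
      · have := Finset.card_le_card (Finset.inter_subset_right (s₁ := X) (s₂ := D.nbrs (S \ B) v))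
        omega
      · have : (X ∩ D.nbrs (S \ B) v).card ≤ 1 := by
          rw [Finset.card_le_one]
          intro x hx y hy
          rw [Finset.mem_inter] at hx hy
          by_contra hxy
          exact hX.indep x hx.1 y hy.1 (h' x hx.2 y hy.2 hxy)
        omega
    · have hvS : v ∈ S \ B := Finset.mem_sdiff.2 ⟨hv, hvB⟩
      refine (Finset.card_le_card fun z hz => ?_).trans (hX.nbhd v hvS)
      rw [Finset.mem_inter, Finset.mem_union, Finset.mem_insert] at hz
      rw [Finset.mem_inter, Finset.mem_insert]
      rcases hz.1 with h | h
      · exact ⟨h, hz.2.imp_right fun h' => mem_nbrs.2 ⟨hX.subset h, (mem_nbrs.1 h').2⟩⟩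
      · exfalso
        rcases hz.2 with rfl | h'
        · exact hvB (hAB h)
        · exact hvB (mem_of_nbrs_subset (hDA z h) hv (mem_nbrs.1 h').2.symm)

lemma HasLargeTwoLimited.of_sdiff {C C' D : SimpleGraph V} {S A B : Finset V} (hAB : A ⊆ B)
    (hBS : B ⊆ S) (hcard : B.card ≤ 3 * A.card) (hS : HasLargeTwoLimited C' D (S \ B))
    (hCC' : ∀ x ∈ S \ B, ∀ y ∈ S \ B, C.Adj x y → C'.Adj x y)
    (hA : ∀ x ∈ A, ∀ y ∈ A, ¬ C.Adj x y)
    (hCA : ∀ a ∈ A, C.nbrs S a ⊆ B) (hDA : ∀ a ∈ A, D.nbrs S a ⊆ B)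
    (hB : ∀ v ∈ B, (A ∩ insert v (D.nbrs S v)).card + (D.nbrs (S \ B) v).card ≤ 2 ∨
      (A ∩ insert v (D.nbrs S v)).card ≤ 1 ∧
        ∀ x ∈ D.nbrs (S \ B) v, ∀ y ∈ D.nbrs (S \ B) v, x ≠ y → C'.Adj x y) :
    HasLargeTwoLimited C D S := by
  obtain ⟨X, hX, hXc⟩ := hS
  refine ⟨X ∪ A, hX.union hAB hBS hCC' hA hCA hDA hB, ?_⟩
  rw [Finset.card_union_of_disjoint]
  · have := Finset.card_sdiff_add_card_eq_card hBS
    omega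
  · exact Finset.disjoint_left.2 fun x hx hxA => (Finset.mem_sdiff.1 (hX.subset hx)).2 (hAB hxA)

/-- If every d-edge is parallel to a c-edge, then each colour class of a 3-colouring of the c-edges is
2-limited. -/
lemma IsAdmissibleOn.hasLarge_of_le {C D : SimpleGraph V} {S : Finset V}
    (h : IsAdmissibleOn C D S) (hDC : ∀ x ∈ S, ∀ y ∈ S, D.Adj x y → C.Adj x y) :
    HasLargeTwoLimited C D S := by
  obtain ⟨f, hf⟩ := exists_properOn_three S
    (fun v hv => le_trans (Nat.le_add_right _ _) (h.degree_le v hv)) h.clique_free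
  obtain ⟨c, -, hc⟩ : ∃ c ∈ (Finset.univ : Finset (Fin 3)),
      S.card ≤ 3 * ({x ∈ S | f x = c} : Finset V).card := by
    by_contra! hcon
    have h1 := Finset.card_eq_sum_card_fiberwise (f := f) (s := S) (t := Finset.univ)
      (fun _ _ => Finset.mem_coe.2 (Finset.mem_univ _))
    rw [Fin.sum_univ_three] at h1
    have := hcon 0 (Finset.mem_univ _)
    have := hcon 1 (Finset.mem_univ _)
    have := hcon 2 (Finset.mem_univ _)
    omega
  refine ⟨_, ⟨Finset.filter_subset _ _, fun x hx y hy hxy => ?_, fun v hv => ?_⟩, hc⟩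
  · rw [Finset.mem_filter] at hx hy
    exact hf x hx.1 y hy.1 hxy (hx.2.trans hy.2.symm)
  · refine (Finset.card_le_card Finset.inter_subset_right).trans
      ((Finset.card_insert_le _ _).trans ?_)
    have : D.nbrs S v ⊆ C.nbrs S v := fun z hz => by
      rw [mem_nbrs] at hz ⊢
      exact ⟨hz.1, hDC v hv z hz.1 hz.2⟩
    have := Finset.card_le_card this
    have := h.degree_le v hv
    omega

/-! ### New c-edges through deleted vertices. -/

/-- Two vertices with a common neighbour in `W` are adjacent. -/
def linkThrough (D : SimpleGraph V) (W : Finset V) : SimpleGraph V where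
  Adj x y := x ≠ y ∧ ∃ w ∈ W, D.Adj w x ∧ D.Adj w y
  symm := ⟨fun _ _ h => ⟨h.1.symm, h.2.imp fun _ hw => ⟨hw.1, hw.2.2, hw.2.1⟩⟩⟩
  loopless := ⟨fun _ h => h.1 rfl⟩

lemma card_biUnion_erase_nbrs_le {D : SimpleGraph V} {T W : Finset V} {x : V} (hx : x ∈ T)
    (hW : ∀ w ∈ W, (D.nbrs T w).card ≤ 2 ∧ D.Adj x w) :
    (W.biUnion fun w => (D.nbrs T w).erase x).card ≤ W.card := by
  refine (Finset.card_biUnion_le_card_mul _ _ 1 fun w hw => ?_).trans_eq (mul_one _)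
  rw [Finset.card_erase_of_mem (mem_nbrs.2 ⟨hx, (hW w hw).2.symm⟩)]
  have := (hW w hw).1
  omega

lemma nbrs_linkThrough_subset {D : SimpleGraph V} {T W : Finset V} (x : V) :
    (D.linkThrough W).nbrs T x ⊆ (D.nbrs W x).biUnion fun w => (D.nbrs T w).erase x := by
  intro y hy
  rw [mem_nbrs] at hy
  obtain ⟨hyT, hxy, w, hw, hwx, hwy⟩ := hy
  exact Finset.mem_biUnion.2 ⟨w, mem_nbrs.2 ⟨hw, hwx.symm⟩,
    Finset.mem_erase.2 ⟨hxy.symm, mem_nbrs.2 ⟨hyT, hwy⟩⟩⟩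

lemma card_nbrs_add_card_nbrs_le {D : SimpleGraph V} {S B W : Finset V} (hBS : B ⊆ S)
    (hWB : W ⊆ B) (x : V) : (D.nbrs W x).card + (D.nbrs (S \ B) x).card ≤ (D.nbrs S x).card := by
  rw [← Finset.card_union_of_disjoint]
  · exact Finset.card_le_card (Finset.union_subset (nbrs_mono D (hWB.trans hBS) x)
      (nbrs_mono D Finset.sdiff_subset x))
  · refine Finset.disjoint_left.2 fun z hz hz' => ?_
    rw [mem_nbrs] at hz hz'
    exact (Finset.mem_sdiff.1 hz'.1).2 (hWB hz.1)

/-- Each deleted d-edge from `v` to some `w ∈ W` produces at most one new c-edge at `v`, since `w`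
has at most one other remaining d-neighbour. -/
lemma degree_le_sup_linkThrough {C D : SimpleGraph V} {S B W : Finset V}
    (hdeg : ∀ v ∈ S, (C.nbrs S v).card + (D.nbrs S v).card ≤ 3) (hBS : B ⊆ S) (hWB : W ⊆ B)
    (hW : ∀ w ∈ W, (D.nbrs (S \ B) w).card ≤ 2) :
    ∀ v ∈ S \ B, ((C ⊔ D.linkThrough W).nbrs (S \ B) v).card + (D.nbrs (S \ B) v).card ≤ 3 := by
  intro v hv
  have hsub : (C ⊔ D.linkThrough W).nbrs (S \ B) v ⊆
      C.nbrs S v ∪ (D.nbrs W v).biUnion fun w => (D.nbrs (S \ B) w).erase v := by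
    intro z hz
    rw [mem_nbrs, sup_adj] at hz
    rcases hz.2 with h | h
    · exact Finset.mem_union_left _ (mem_nbrs.2 ⟨Finset.sdiff_subset hz.1, h⟩)
    · exact Finset.mem_union_right _ (nbrs_linkThrough_subset v (mem_nbrs.2 ⟨hz.1, h⟩))
  have h1 := (Finset.card_le_card hsub).trans (Finset.card_union_le _ _)
  have h2 := card_biUnion_erase_nbrs_le (D := D) (W := D.nbrs W v) hv
    fun w hw => ⟨hW w (mem_nbrs.1 hw).1, (mem_nbrs.1 hw).2⟩
  have h3 := card_nbrs_add_card_nbrs_le (D := D) hBS hWB v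
  have h4 := hdeg v (Finset.sdiff_subset hv)
  omega

/-- A vertex `x` of a `K₄` arising from links through `W` has no c-neighbours outside of the `K₄`,
all its d-neighbours lie in `W`, and each of them provides a private edge of the `K₄` at `x`. -/
lemma IsNClique.links_at {C D : SimpleGraph V} {S B W K : Finset V}
    (hdeg : ∀ v ∈ S, (C.nbrs S v).card + (D.nbrs S v).card ≤ 3) (hBS : B ⊆ S) (hWB : W ⊆ B)
    (hW : ∀ w ∈ W, (D.nbrs (S \ B) w).card ≤ 2) (hKS : K ⊆ S \ B)
    (hK : (C ⊔ D.linkThrough W).IsNClique 4 K) {x : V} (hx : x ∈ K) :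
    C.nbrs S x ⊆ K ∧ D.nbrs S x ⊆ W ∧ ∀ w ∈ D.nbrs S x, ∃ y ∈ K, y ≠ x ∧ D.Adj w y ∧
      ¬ C.Adj x y ∧ ∀ w' ∈ S, w' ≠ w → D.Adj w' x → ¬ D.Adj w' y := by
  rw [isNClique_iff] at hK
  have hKS' : K ⊆ S := hKS.trans Finset.sdiff_subset
  have hcover : K.erase x ⊆ C.nbrs K x ∪ (D.nbrs W x).biUnion fun w => (D.nbrs K w).erase x := by
    intro y hy
    rw [Finset.mem_erase] at hy
    have := hK.1 hx hy.2 hy.1.symm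
    rw [sup_adj] at this
    rcases this with h | h
    · exact Finset.mem_union_left _ (mem_nbrs.2 ⟨hy.2, h⟩)
    · exact Finset.mem_union_right _ (nbrs_linkThrough_subset x (mem_nbrs.2 ⟨hy.2, h⟩))
  have hKW : ∀ w ∈ W, (D.nbrs K w).card ≤ 2 := fun w hw =>
    (Finset.card_le_card (nbrs_mono D hKS w)).trans (hW w hw)
  have h3 : (K.erase x).card = 3 := by rw [Finset.card_erase_of_mem hx, hK.2]
  have hCK := nbrs_mono C hKS' x
  have hDW := nbrs_mono D (hWB.trans hBS) x
  have hCc := Finset.card_le_card hCK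
  have hDc := Finset.card_le_card hDW
  have hd := hdeg x (hKS' hx)
  have h1 := (Finset.card_le_card hcover).trans (Finset.card_union_le _ _)
  have h2 := card_biUnion_erase_nbrs_le (D := D) (W := D.nbrs W x) hx
    fun w hw => ⟨hKW w (mem_nbrs.1 hw).1, (mem_nbrs.1 hw).2⟩
  -- The three other vertices of `K` must be reached by c-edges or links, at most one for each edge
  -- at `x`. As `x` has degree at most 3, equality holds throughout.
  have hCeq : C.nbrs K x = C.nbrs S x := Finset.eq_of_subset_of_card_le hCK (by omega)
  have hDeq : D.nbrs W x = D.nbrs S x := Finset.eq_of_subset_of_card_le hDW (by omega)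
  refine ⟨?_, ?_, fun w hw => ?_⟩
  · rw [← hCeq]
    exact fun z hz => (mem_nbrs.1 hz).1
  · rw [← hDeq]
    exact fun z hz => (mem_nbrs.1 hz).1
  -- If `w` had no private edge, the cover of `K.erase x` would survive without `w`, and the count
  -- would fall below three.
  · by_contra! hcon
    have hcover' : K.erase x ⊆ C.nbrs K x ∪
        ((D.nbrs W x).erase w).biUnion fun w => (D.nbrs K w).erase x := by
      intro y hy
      rcases Finset.mem_union.1 (hcover hy) with h | h
      · exact Finset.mem_union_left _ h
      · rw [Finset.mem_biUnion] at h
        obtain ⟨w', hw', hyw'⟩ := h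
        by_cases hww : w' = w
        · subst hww
          rw [Finset.mem_erase, mem_nbrs] at hyw'
          by_cases hCxy : C.Adj x y
          · exact Finset.mem_union_left _ (mem_nbrs.2 ⟨hyw'.2.1, hCxy⟩)
          · obtain ⟨w2, hw2S, hw2, hw2x, hw2y⟩ := hcon y hyw'.2.1 hyw'.1 hyw'.2.2 hCxy
            refine Finset.mem_union_right _ (Finset.mem_biUnion.2 ⟨w2, Finset.mem_erase.2
              ⟨hw2, ?_⟩, Finset.mem_erase.2 ⟨hyw'.1, mem_nbrs.2 ⟨hyw'.2.1, hw2y⟩⟩⟩)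
            rw [hDeq]
            exact mem_nbrs.2 ⟨hw2S, hw2x.symm⟩
        · exact Finset.mem_union_right _ (Finset.mem_biUnion.2
            ⟨w', Finset.mem_erase.2 ⟨hww, hw'⟩, hyw'⟩)
    have h1' := (Finset.card_le_card hcover').trans (Finset.card_union_le _ _)
    have h2' := card_biUnion_erase_nbrs_le (D := D) (W := (D.nbrs W x).erase w) hx
      fun w hw => ⟨hKW w (mem_nbrs.1 (Finset.mem_of_mem_erase hw)).1,
        (mem_nbrs.1 (Finset.mem_of_mem_erase hw)).2⟩
    rw [← hDeq] at hw
    rw [Finset.card_erase_of_mem hw] at h2'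
    have := Finset.card_pos.2 ⟨w, hw⟩
    omega

lemma card_nbrs_sdiff_add_one_le {D : SimpleGraph V} {S B : Finset V} {x z : V} (hzS : z ∈ S)
    (hzB : z ∈ B) (hxz : D.Adj x z) : (D.nbrs (S \ B) x).card + 1 ≤ (D.nbrs S x).card := by
  rw [← Finset.card_insert_of_notMem (a := z)]
  · exact Finset.card_le_card (Finset.insert_subset (mem_nbrs.2 ⟨hzS, hxz⟩)
      (nbrs_mono D Finset.sdiff_subset x))
  · exact fun h => (Finset.mem_sdiff.1 (mem_nbrs.1 h).1).2 hzB

lemma nbrs_sdiff_eq_empty {D : SimpleGraph V} {S B : Finset V} {x : V} (h : D.nbrs S x ⊆ B) :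
    D.nbrs (S \ B) x = ∅ := by
  refine Finset.eq_empty_of_forall_notMem fun z hz => ?_
  rw [mem_nbrs, Finset.mem_sdiff] at hz
  exact hz.1.2 (mem_of_nbrs_subset h hz.1.1 hz.2)

/-! ### The reduction at a newly created `K₄`. -/

/-- The reduction at a set `K` of four vertices which is separated from the rest of the graph by
its set `O` of d-neighbours. The vertices `p`, `q` and those in `O'` are chosen, and `K`, `O` and
the remaining neighbours `T` of `O` are deleted. -/
lemma IsAdmissibleOn.hasLarge_of_gadget {C D : SimpleGraph V} {S K O O' T : Finset V} {p q : V}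
    (hadm : IsAdmissibleOn C D S)
    (ih : ∀ R ⊂ S, IsAdmissibleOn C D R → HasLargeTwoLimited C D R)
    (hKS : K ⊆ S) (hK4 : K.card = 4) (hCK : ∀ x ∈ K, C.nbrs S x ⊆ K)
    (hDK : ∀ x ∈ K, D.nbrs S x ⊆ O) (hOS : O ⊆ S) (hOK : Disjoint O K)
    (hOC : ∀ w ∈ O, C.nbrs S w = ∅) (hOD : ∀ w ∈ O, D.nbrs S w ⊆ K ∪ T)
    (hTS : T ⊆ S) (hTK : Disjoint T K) (hTO : Disjoint T O)
    (hT : ∀ t ∈ T, ∃ z ∈ O ∪ T, z ∉ O' ∧ D.Adj t z)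
    (hp : p ∈ K) (hq : q ∈ K) (hpq : p ≠ q) (hCpq : ¬ C.Adj p q) (hO'O : O' ⊆ O)
    (hO'pq : ∀ w ∈ O', ¬ (D.Adj w p ∧ D.Adj w q)) (hO'p : (D.nbrs O' p).card ≤ 1)
    (hO'q : (D.nbrs O' q).card ≤ 1) (hO'2 : O'.card ≤ 2)
    (hcard : 4 + O.card + T.card ≤ 3 * (2 + O'.card)) : HasLargeTwoLimited C D S := by
  have hKO : ∀ x ∈ K, x ∉ O := fun x hx hxO => Finset.disjoint_left.1 hOK hxO hx
  have hKT : ∀ x ∈ K, x ∉ T := fun x hx hxT => Finset.disjoint_left.1 hTK hxT hx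
  have hOT : ∀ x ∈ O, x ∉ T := fun x hx hxT => Finset.disjoint_left.1 hTO hxT hx
  set B := K ∪ O ∪ T with hB
  have hBm : ∀ x, x ∈ B ↔ x ∈ K ∨ x ∈ O ∨ x ∈ T := by
    intro x; rw [hB, Finset.mem_union, Finset.mem_union, or_assoc]
  set A := insert p (insert q O') with hA
  have hAm : ∀ x, x ∈ A ↔ x = p ∨ x = q ∨ x ∈ O' := by
    intro x; rw [hA, Finset.mem_insert, Finset.mem_insert]
  have hBS : B ⊆ S := by
    intro x hx
    rcases (hBm x).1 hx with h | h | h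
    exacts [hKS h, hOS h, hTS h]
  have hAB : A ⊆ B := by
    intro x hx
    rw [hBm]
    rcases (hAm x).1 hx with rfl | rfl | h
    exacts [Or.inl hp, Or.inl hq, Or.inr (Or.inl (hO'O h))]
  have hAcard : A.card = 2 + O'.card := by
    rw [hA, Finset.card_insert_of_notMem, Finset.card_insert_of_notMem]
    · omega
    · exact fun h => hKO q hq (hO'O h)
    · rw [Finset.mem_insert, not_or]
      exact ⟨hpq, fun h => hKO p hp (hO'O h)⟩
  have hBcard : B.card ≤ 4 + O.card + T.card := by
    rw [hB, ← hK4]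
    exact (Finset.card_union_le _ _).trans (Nat.add_le_add_right (Finset.card_union_le _ _) _)
  have hOnoC : ∀ w ∈ O, ∀ z ∈ S, ¬ C.Adj w z := fun w hw z hz h => by
    have := mem_nbrs.2 ⟨hz, h⟩
    rw [hOC w hw] at this
    simp at this
  have hss : S \ B ⊂ S :=
    (Finset.ssubset_iff_of_subset Finset.sdiff_subset).2 ⟨p, hKS hp, fun h =>
      (Finset.mem_sdiff.1 h).2 ((hBm p).2 (Or.inl hp))⟩
  refine HasLargeTwoLimited.of_sdiff hAB hBS (by omega)
    (ih _ hss (hadm.mono Finset.sdiff_subset)) (fun _ _ _ _ h => h) ?_ ?_ ?_ ?_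
  · intro x hx y hy hxy
    have hxS := hBS (hAB hx)
    have hyS := hBS (hAB hy)
    rcases (hAm x).1 hx with rfl | rfl | h
    · rcases (hAm y).1 hy with rfl | rfl | h'
      exacts [hxy.ne rfl, hCpq hxy, hOnoC y (hO'O h') _ hxS hxy.symm]
    · rcases (hAm y).1 hy with rfl | rfl | h'
      exacts [hCpq hxy.symm, hxy.ne rfl, hOnoC y (hO'O h') _ hxS hxy.symm]
    · exact hOnoC x (hO'O h) y hyS hxy
  · intro a ha z hz
    rw [hBm]
    rcases (hAm a).1 ha with rfl | rfl | h
    · exact Or.inl (hCK _ hp hz)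
    · exact Or.inl (hCK _ hq hz)
    · rw [hOC a (hO'O h)] at hz
      simp at hz
  · intro a ha z hz
    rw [hBm]
    rcases (hAm a).1 ha with rfl | rfl | h
    · exact Or.inr (Or.inl (hDK _ hp hz))
    · exact Or.inr (Or.inl (hDK _ hq hz))
    · rcases Finset.mem_union.1 (hOD a (hO'O h) hz) with h | h
      exacts [Or.inl h, Or.inr (Or.inr h)]
  · intro v hv
    left
    rcases (hBm v).1 hv with hvK | hvO | hvT
    · rw [nbrs_sdiff_eq_empty fun z hz => (hBm z).2 (Or.inr (Or.inl (hDK v hvK hz))),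
        Finset.card_empty, add_zero]
      have hmem : ∀ z ∈ A ∩ insert v (D.nbrs S v), z = v ∧ (v = p ∨ v = q) ∨ z ∈ D.nbrs O' v := by
        intro z hz
        rw [Finset.mem_inter, hAm, Finset.mem_insert] at hz
        obtain ⟨h1, h2⟩ := hz
        rcases h2 with rfl | h2
        · rcases h1 with h1 | h1 | h1
          · exact Or.inl ⟨rfl, Or.inl h1⟩
          · exact Or.inl ⟨rfl, Or.inr h1⟩
          · exact absurd (hO'O h1) (hKO _ hvK)
        · rcases h1 with rfl | rfl | h1
          · exact absurd (hDK v hvK h2) (hKO _ hp)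
          · exact absurd (hDK v hvK h2) (hKO _ hq)
          · exact Or.inr (mem_nbrs.2 ⟨h1, (mem_nbrs.1 h2).2⟩)
      by_cases hvpq : v = p ∨ v = q
      · have hsub : A ∩ insert v (D.nbrs S v) ⊆ insert v (D.nbrs O' v) := fun z hz =>
          Finset.mem_insert.2 ((hmem z hz).imp_left And.left)
        refine (Finset.card_le_card hsub).trans ((Finset.card_insert_le _ _).trans ?_)
        rcases hvpq with rfl | rfl <;> omega
      · have hsub : A ∩ insert v (D.nbrs S v) ⊆ O' := fun z hz => by
          rcases hmem z hz with h | h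
          · exact absurd h.2 hvpq
          · exact (mem_nbrs.1 h).1
        exact (Finset.card_le_card hsub).trans hO'2
    · rw [nbrs_sdiff_eq_empty, Finset.card_empty, add_zero]
      · have hmem : ∀ z ∈ A ∩ insert v (D.nbrs S v), z = v ∧ v ∈ O' ∨ z = p ∧ D.Adj v p ∨
            z = q ∧ D.Adj v q := by
          intro z hz
          rw [Finset.mem_inter, hAm, Finset.mem_insert] at hz
          obtain ⟨h1, h2⟩ := hz
          rcases h2 with rfl | h2
          · rcases h1 with rfl | rfl | h1
            · exact absurd hvO (hKO _ hp)
            · exact absurd hvO (hKO _ hq)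
            · exact Or.inl ⟨rfl, h1⟩
          · rcases h1 with rfl | rfl | h1
            · exact Or.inr (Or.inl ⟨rfl, (mem_nbrs.1 h2).2⟩)
            · exact Or.inr (Or.inr ⟨rfl, (mem_nbrs.1 h2).2⟩)
            · rcases Finset.mem_union.1 (hOD v hvO h2) with h | h
              · exact absurd (hO'O h1) (hKO _ h)
              · exact absurd h (hOT _ (hO'O h1))
        -- Only `v`, `p` and `q` can occur here; if `v` itself is chosen, it sees at most one of
        -- `p`, `q`.
        have hpair : ∃ a b, A ∩ insert v (D.nbrs S v) ⊆ {a, b} := by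
          by_cases hvO' : v ∈ O'
          · by_cases hvp : D.Adj v p
            · refine ⟨v, p, fun z hz => ?_⟩
              have := hO'pq v hvO'
              rcases hmem z hz with h | h | h
              · simp [h.1]
              · simp [h.1]
              · tauto
            · refine ⟨v, q, fun z hz => ?_⟩
              rcases hmem z hz with h | h | h
              · simp [h.1]
              · tauto
              · simp [h.1]
          · refine ⟨p, q, fun z hz => ?_⟩
            rcases hmem z hz with h | h | h
            · tauto
            · simp [h.1]
            · simp [h.1]
        obtain ⟨a, b, hab⟩ := hpair
        exact (Finset.card_le_card hab).trans Finset.card_le_two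
      · intro z hz
        rw [hBm]
        rcases Finset.mem_union.1 (hOD v hvO hz) with h | h
        exacts [Or.inl h, Or.inr (Or.inr h)]
    -- The vertex `v` is not chosen, and its d-neighbour `z` is deleted without being chosen, so at
    -- most two d-neighbours of `v` can enter the final set.
    · obtain ⟨z, hz, hzO', hvz⟩ := hT v hvT
      have hzOT := Finset.mem_union.1 hz
      have hzB : z ∈ B := (hBm z).2 (Or.inr hzOT)
      have hzA : z ∉ A := by
        rw [hAm]
        rintro (rfl | rfl | h)
        · exact hzOT.elim (hKO _ hp) (hKT _ hp)
        · exact hzOT.elim (hKO _ hq) (hKT _ hq)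
        · exact hzO' h
      rw [← Finset.card_union_of_disjoint]
      · have hsub : A ∩ insert v (D.nbrs S v) ∪ D.nbrs (S \ B) v ⊆ (D.nbrs S v).erase z := by
          intro y hy
          rw [Finset.mem_erase]
          rcases Finset.mem_union.1 hy with h | h
          · have hyA := (Finset.mem_inter.1 h).1
            refine ⟨fun hyz => hzA (hyz ▸ hyA), ?_⟩
            rcases Finset.mem_insert.1 (Finset.mem_inter.1 h).2 with rfl | h2
            · exfalso
              rcases (hAm y).1 hyA with rfl | rfl | h1
              exacts [hKT _ hp hvT, hKT _ hq hvT, hOT _ (hO'O h1) hvT]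
            · exact h2
          · refine ⟨fun hyz => ?_, nbrs_mono D Finset.sdiff_subset v h⟩
            subst hyz
            exact (Finset.mem_sdiff.1 (mem_nbrs.1 h).1).2 hzB
        refine (Finset.card_le_card hsub).trans ?_
        rw [Finset.card_erase_of_mem (mem_nbrs.2 ⟨hBS hzB, hvz⟩)]
        have := hadm.degree_le v (hTS hvT)
        omega
      · refine Finset.disjoint_left.2 fun y hy hy' => ?_
        exact (Finset.mem_sdiff.1 (mem_nbrs.1 hy').1).2 (hAB (Finset.mem_inter.1 hy).1)

/-- A property that fails at one of three elements rules out at most one of the three pairs, so two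
such properties leave a pair. -/
lemma _root_.Finset.exists_pair_of_card_eq_three {O : Finset V} (h : O.card = 3)
    {P Q : V → Prop} (hP : ¬ ∀ x ∈ O, P x) (hQ : ¬ ∀ x ∈ O, Q x)
    (hPQ : ∀ x ∈ O, ¬ (P x ∧ Q x)) :
    ∃ a ∈ O, ∃ b ∈ O, a ≠ b ∧ ¬ (P a ∧ P b) ∧ ¬ (Q a ∧ Q b) := by
  obtain ⟨x, y, z, hxy, hxz, hyz, rfl⟩ := Finset.card_eq_three.1 h
  simp only [Finset.mem_insert, Finset.mem_singleton, forall_eq_or_imp, forall_eq] at hP hQ hPQ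
  by_contra! hcon
  have h1 := hcon x (by simp) y (by simp) hxy
  have h2 := hcon x (by simp) z (by simp) hxz
  have h3 := hcon y (by simp) z (by simp) hyz
  tauto

/-! ### The reduction at a d-edge without a parallel c-edge. -/

/-- The vertices deleted when both ends of the d-edge `uv` are chosen: `u`, `v`, their neighbours,
and the d-neighbours of their common d-neighbours. -/
noncomputable def edgeBall (C D : SimpleGraph V) (S : Finset V) (u v : V) : Finset V :=
  {u, v} ∪ (((C.nbrs S u ∪ D.nbrs S u).erase v ∪ (C.nbrs S v ∪ D.nbrs S v).erase u) ∪
    (D.nbrs (D.nbrs S u) v).biUnion fun w => D.nbrs S w \ {u, v})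

lemma mem_edgeBall {C D : SimpleGraph V} {S : Finset V} {u v z : V} :
    z ∈ edgeBall C D S u v ↔ z = u ∨ z = v ∨ z ∈ S ∧ (C.Adj u z ∨ D.Adj u z ∨ C.Adj v z ∨
      D.Adj v z ∨ ∃ w ∈ S, D.Adj u w ∧ D.Adj v w ∧ D.Adj w z) := by
  simp only [edgeBall, Finset.mem_union, Finset.mem_insert, Finset.mem_singleton,
    Finset.mem_erase, mem_nbrs, Finset.mem_biUnion, Finset.mem_sdiff]
  constructor
  · rintro ((h | h) | (h | h) | ⟨w, hw, h⟩)
    · exact Or.inl h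
    · exact Or.inr (Or.inl h)
    · tauto
    · tauto
    · exact Or.inr (Or.inr ⟨h.1.1, Or.inr (Or.inr (Or.inr (Or.inr ⟨w, hw.1.1, hw.1.2, hw.2, h.1.2⟩)))⟩)
  · intro h
    by_cases hu : z = u
    · exact Or.inl (Or.inl hu)
    by_cases hv : z = v
    · exact Or.inl (Or.inr hv)
    rcases h with h | h | ⟨hz, h | h | h | h | ⟨w, hw, h1, h2, h3⟩⟩
    · exact absurd h hu
    · exact absurd h hv
    · tauto
    · tauto
    · tauto
    · tauto
    · exact Or.inr (Or.inr ⟨w, ⟨⟨hw, h1⟩, h2⟩, ⟨hz, h3⟩, by tauto⟩)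

lemma edgeBall_subset {C D : SimpleGraph V} {S : Finset V} {u v : V} (hu : u ∈ S) (hv : v ∈ S) :
    edgeBall C D S u v ⊆ S := by
  intro z hz
  rcases mem_edgeBall.1 hz with rfl | rfl | h
  exacts [hu, hv, h.1]

/-- Besides each other, `u` and `v` have at most two neighbours each. A common d-neighbour is
counted twice among these four and brings in at most one further vertex, so the total stays at most
`2 + 4`. -/
lemma card_edgeBall_le {C D : SimpleGraph V} {S : Finset V} {u v : V}
    (hdeg : ∀ v ∈ S, (C.nbrs S v).card + (D.nbrs S v).card ≤ 3) (hu : u ∈ S) (hv : v ∈ S)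
    (huv : D.Adj u v) : (edgeBall C D S u v).card ≤ 6 := by
  have hP : ∀ x ∈ S, ∀ y ∈ S, D.Adj x y → ((C.nbrs S x ∪ D.nbrs S x).erase y).card ≤ 2 := by
    intro x hx y hy hxy
    rw [Finset.card_erase_of_mem (Finset.mem_union_right _ (mem_nbrs.2 ⟨hy, hxy⟩))]
    have := Finset.card_union_le (C.nbrs S x) (D.nbrs S x)
    have := hdeg x hx
    omega
  set P := (C.nbrs S u ∪ D.nbrs S u).erase v with hPdef
  set Q := (C.nbrs S v ∪ D.nbrs S v).erase u with hQdef
  have hP2 : P.card ≤ 2 := hP u hu v hv huv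
  have hQ2 : Q.card ≤ 2 := hP v hv u hu huv.symm
  have hM : D.nbrs (D.nbrs S u) v ⊆ P ∩ Q := by
    intro w hw
    rw [mem_nbrs, mem_nbrs] at hw
    rw [Finset.mem_inter, hPdef, hQdef]
    exact ⟨Finset.mem_erase.2 ⟨hw.2.ne.symm, Finset.mem_union_right _ (mem_nbrs.2 hw.1)⟩,
      Finset.mem_erase.2 ⟨hw.1.2.ne.symm, Finset.mem_union_right _ (mem_nbrs.2 ⟨hw.1.1, hw.2⟩)⟩⟩
  have hMc := Finset.card_le_card hM
  have hPQ := Finset.card_union_add_card_inter P Q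
  have hbi : ((D.nbrs (D.nbrs S u) v).biUnion fun w => D.nbrs S w \ {u, v}).card ≤
      (D.nbrs (D.nbrs S u) v).card := by
    refine (Finset.card_biUnion_le_card_mul _ _ 1 fun w hw => ?_).trans_eq (mul_one _)
    rw [mem_nbrs, mem_nbrs] at hw
    have hsub : ({u, v} : Finset V) ⊆ D.nbrs S w := by
      intro z hz
      rw [Finset.mem_insert, Finset.mem_singleton] at hz
      rcases hz with rfl | rfl
      exacts [mem_nbrs.2 ⟨hu, hw.1.2.symm⟩, mem_nbrs.2 ⟨hv, hw.2.symm⟩]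
    have h1 := Finset.card_sdiff_add_card_eq_card hsub
    rw [Finset.card_pair huv.ne] at h1
    have := hdeg w hw.1.1
    omega
  have h2 := Finset.card_union_le (P ∪ Q)
    ((D.nbrs (D.nbrs S u) v).biUnion fun w => D.nbrs S w \ {u, v})
  have h3 := Finset.card_union_le {u, v} ((P ∪ Q) ∪
    (D.nbrs (D.nbrs S u) v).biUnion fun w => D.nbrs S w \ {u, v})
  have h4 : ({u, v} : Finset V).card ≤ 2 := Finset.card_le_two
  unfold edgeBall
  rw [← hPdef, ← hQdef]
  omega

/-- Both ends of a d-edge can be chosen, if the c-edges that have to be added to the remaining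
graph do not create a `K₄`. -/
lemma IsAdmissibleOn.hasLarge_of_edge {C D : SimpleGraph V} {S : Finset V} {u v : V}
    (hadm : IsAdmissibleOn C D S) (hu : u ∈ S) (hv : v ∈ S) (huv : D.Adj u v)
    (hCuv : ¬ C.Adj u v)
    (h : HasLargeTwoLimited (C ⊔ D.linkThrough (D.nbrs S u ∪ D.nbrs S v)) D
      (S \ edgeBall C D S u v)) : HasLargeTwoLimited C D S := by
  have hBS := edgeBall_subset (C := C) (D := D) hu hv
  set B := edgeBall C D S u v with hB
  have hBm : ∀ z, z ∈ B ↔ _ := fun z => mem_edgeBall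
  have huB : u ∈ B := (hBm u).2 (Or.inl rfl)
  have hvB : v ∈ B := (hBm v).2 (Or.inr (Or.inl rfl))
  have hA : ∀ z, z ∈ ({u, v} : Finset V) ↔ z = u ∨ z = v := by simp
  have hDu : D.nbrs S u ⊆ B := fun z hz => by
    rw [mem_nbrs] at hz
    rw [hBm]; tauto
  have hDv : D.nbrs S v ⊆ B := fun z hz => by
    rw [mem_nbrs] at hz
    rw [hBm]; tauto
  refine HasLargeTwoLimited.of_sdiff (A := {u, v}) (B := B) (fun z hz => ?_) hBS ?_ h
    (fun x _ y _ hxy => Or.inl hxy) ?_ ?_ ?_ ?_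
  · rcases (hA z).1 hz with rfl | rfl <;> assumption
  · rw [Finset.card_pair huv.ne]
    exact card_edgeBall_le hadm.degree_le hu hv huv
  · intro x hx y hy hxy
    rcases (hA x).1 hx with rfl | rfl <;> rcases (hA y).1 hy with rfl | rfl
    exacts [hxy.ne rfl, hCuv hxy, hCuv hxy.symm, hxy.ne rfl]
  · intro a ha z hz
    rw [mem_nbrs] at hz
    rw [hBm]
    rcases (hA a).1 ha with rfl | rfl <;> tauto
  · intro a ha
    rcases (hA a).1 ha with rfl | rfl <;> assumption
  · intro z hz
    have hzS := hBS hz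
    have hle2 : ({u, v} ∩ insert z (D.nbrs S z)).card ≤ 2 :=
      (Finset.card_le_card Finset.inter_subset_left).trans Finset.card_le_two
    -- A vertex `z` with a d-neighbour outside `B` is neither an end of `uv` nor a common
    -- d-neighbour of the ends. If it is a d-neighbour of one end, the added c-edges apply;
    -- otherwise it sees no chosen vertex of `A` and loses an edge to `B`.
    by_cases hempty : D.nbrs S z ⊆ B
    · left
      rw [nbrs_sdiff_eq_empty hempty]
      simpa using hle2
    have hzu : z ≠ u := by rintro rfl; exact hempty hDu
    have hzv : z ≠ v := by rintro rfl; exact hempty hDv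
    have hmem : ∀ y ∈ ({u, v} : Finset V) ∩ insert z (D.nbrs S z),
        y = u ∧ D.Adj u z ∨ y = v ∧ D.Adj v z := by
      intro y hy
      rw [Finset.mem_inter, hA, Finset.mem_insert] at hy
      obtain ⟨h1, h2⟩ := hy
      rcases h2 with rfl | h2
      · tauto
      · rw [mem_nbrs] at h2
        rcases h1 with rfl | rfl
        exacts [Or.inl ⟨rfl, h2.2.symm⟩, Or.inr ⟨rfl, h2.2.symm⟩]
    have hnot : ¬ (D.Adj u z ∧ D.Adj v z) := by
      rintro ⟨h1, h2⟩
      refine hempty fun y hy => ?_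
      rw [mem_nbrs] at hy
      rw [hBm]
      exact Or.inr (Or.inr ⟨hy.1, Or.inr (Or.inr (Or.inr (Or.inr ⟨z, hzS, h1, h2, hy.2⟩)))⟩)
    by_cases hW : D.Adj u z ∨ D.Adj v z
    · right
      constructor
      · rw [Finset.card_le_one]
        intro a ha b hb
        rcases hmem a ha with ⟨rfl, h1⟩ | ⟨rfl, h1⟩ <;> rcases hmem b hb with ⟨rfl, h2⟩ | ⟨rfl, h2⟩
        · rfl
        · exact absurd ⟨h1, h2⟩ hnot
        · exact absurd ⟨h2, h1⟩ hnot
        · rfl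
      · intro x hx y hy hxy
        rw [mem_nbrs] at hx hy
        refine Or.inr ⟨hxy, z, ?_, hx.2, hy.2⟩
        rw [Finset.mem_union, mem_nbrs, mem_nbrs]
        exact hW.imp (⟨hzS, ·⟩) (⟨hzS, ·⟩)
    · left
      have h0 : ({u, v} : Finset V) ∩ insert z (D.nbrs S z) = ∅ := by
        refine Finset.eq_empty_of_forall_notMem fun y hy => ?_
        rcases hmem y hy with h | h <;> tauto
      rw [h0, Finset.card_empty, zero_add]
      have hd := hadm.degree_le z hzS
      rcases (hBm z).1 hz with h | h | ⟨-, h | h | h | h | ⟨w, hw, h1, h2, h3⟩⟩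
      · exact absurd h hzu
      · exact absurd h hzv
      · have := Finset.card_pos.2 ⟨u, mem_nbrs.2 ⟨hu, h.symm⟩⟩
        have := Finset.card_le_card (nbrs_mono D (Finset.sdiff_subset (s := S) (t := B)) z)
        omega
      · tauto
      · have := Finset.card_pos.2 ⟨v, mem_nbrs.2 ⟨hv, h.symm⟩⟩
        have := Finset.card_le_card (nbrs_mono D (Finset.sdiff_subset (s := S) (t := B)) z)
        omega
      · tauto
      · have := card_nbrs_sdiff_add_one_le (D := D) hw (hDu (mem_nbrs.2 ⟨hw, h1⟩)) h3.symm
        omega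

/-- A `K₄` created by the c-edges added for the d-edge `uv` can be removed by another reduction,
which adds no edges. -/
lemma IsAdmissibleOn.hasLarge_of_clique {C D : SimpleGraph V} {S : Finset V} {u v : V}
    (hadm : IsAdmissibleOn C D S)
    (ih : ∀ R ⊂ S, IsAdmissibleOn C D R → HasLargeTwoLimited C D R)
    (hu : u ∈ S) (hv : v ∈ S) (huv : D.Adj u v)
    (hW2 : ∀ w ∈ D.nbrs S u ∪ D.nbrs S v, (D.nbrs (S \ edgeBall C D S u v) w).card ≤ 2)
    (hWB : D.nbrs S u ∪ D.nbrs S v ⊆ edgeBall C D S u v)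
    {K : Finset V} (hKS : K ⊆ S \ edgeBall C D S u v)
    (hK : (C ⊔ D.linkThrough (D.nbrs S u ∪ D.nbrs S v)).IsNClique 4 K) :
    HasLargeTwoLimited C D S := by
  have hBS := edgeBall_subset (C := C) (D := D) hu hv
  have huB : u ∈ edgeBall C D S u v := mem_edgeBall.2 (Or.inl rfl)
  have hvB : v ∈ edgeBall C D S u v := mem_edgeBall.2 (Or.inr (Or.inl rfl))
  have hat := fun x hx => hK.links_at hadm.degree_le hBS hWB hW2 hKS (x := x) hx
  set B := edgeBall C D S u v with hB
  set W := D.nbrs S u ∪ D.nbrs S v with hWdef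
  have hKB : ∀ x ∈ K, x ∉ B := fun x hx => (Finset.mem_sdiff.1 (hKS hx)).2
  have hKS' : K ⊆ S := hKS.trans Finset.sdiff_subset
  set O := K.biUnion (D.nbrs S) with hO
  have hOm : ∀ w, w ∈ O ↔ ∃ x ∈ K, w ∈ S ∧ D.Adj x w := by
    intro w; simp [hO]
  have hOW : O ⊆ W := Finset.biUnion_subset.2 fun x hx => (hat x hx).2.1
  have hOS : O ⊆ S := hOW.trans (hWB.trans hBS)
  have hOK : Disjoint O K := Finset.disjoint_left.2 fun w hw hwK => hKB w hwK (hWB (hOW hw))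
  have huO : u ∉ O := by
    rw [hOm]
    rintro ⟨x, hx, -, h⟩
    exact hKB x hx (mem_edgeBall.2 (Or.inr (Or.inr ⟨hKS' hx, Or.inr (Or.inl h.symm)⟩)))
  have hvO : v ∉ O := by
    rw [hOm]
    rintro ⟨x, hx, -, h⟩
    exact hKB x hx (mem_edgeBall.2 (Or.inr (Or.inr ⟨hKS' hx, by tauto⟩)))
  have hOt : ∀ w ∈ O, ∃ t, (t = u ∨ t = v) ∧ D.Adj w t := by
    intro w hw
    rcases Finset.mem_union.1 (hOW hw) with h | h
    exacts [⟨u, Or.inl rfl, (mem_nbrs.1 h).2.symm⟩, ⟨v, Or.inr rfl, (mem_nbrs.1 h).2.symm⟩]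
  have huvS : ∀ t, t = u ∨ t = v → t ∈ S ∧ t ∈ B ∧ t ∉ K ∧ t ∉ O := by
    rintro t (rfl | rfl)
    exacts [⟨hu, huB, fun h => hKB _ h huB, huO⟩, ⟨hv, hvB, fun h => hKB _ h hvB, hvO⟩]
  have hOxy : ∀ w ∈ O, ∃ x ∈ K, ∃ y ∈ K, x ≠ y ∧ D.Adj w x ∧ D.Adj w y := by
    intro w hw
    obtain ⟨x, hx, hwS, hxw⟩ := (hOm w).1 hw
    obtain ⟨y, hy, hyx, hwy, -⟩ := (hat x hx).2.2 w (mem_nbrs.2 ⟨hwS, hxw⟩)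
    exact ⟨x, hx, y, hy, hyx.symm, hxw.symm, hwy⟩
  have hD3 : ∀ w ∈ S, (D.nbrs S w).card ≤ 3 := fun w hw =>
    le_trans (Nat.le_add_left _ _) (hadm.degree_le w hw)
  -- Two d-neighbours in `K` and one in `{u, v}` exhaust the degree of `w`.
  have hthree : ∀ w ∈ O, ∀ x ∈ K, ∀ y ∈ K, x ≠ y → D.Adj w x → D.Adj w y →
      ∀ t, t = u ∨ t = v → D.Adj w t → ∀ z ∈ S, D.Adj w z → z = x ∨ z = y ∨ z = t := by
    intro w hw x hx y hy hxy hwx hwy t ht hwt z hz hwz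
    refine eq_or_eq_or_eq_of_adj (hD3 w (hOS hw)) (hKS' hx) (hKS' hy) (huvS t ht).1 hz hwx hwy hwt
      hwz hxy ?_ ?_
    · rintro rfl; exact (huvS _ ht).2.2.1 hx
    · rintro rfl; exact (huvS _ ht).2.2.1 hy
  have hOC : ∀ w ∈ O, C.nbrs S w = ∅ := by
    intro w hw
    obtain ⟨x, hx, y, hy, hxy, hwx, hwy⟩ := hOxy w hw
    obtain ⟨t, ht, hwt⟩ := hOt w hw
    have hsub : ({x, y, t} : Finset V) ⊆ D.nbrs S w := by
      intro z hz
      simp only [Finset.mem_insert, Finset.mem_singleton] at hz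
      rw [mem_nbrs]
      rcases hz with rfl | rfl | rfl
      exacts [⟨hKS' hx, hwx⟩, ⟨hKS' hy, hwy⟩, ⟨(huvS _ ht).1, hwt⟩]
    have hxt : x ≠ t := by rintro rfl; exact (huvS _ ht).2.2.1 hx
    have hyt : y ≠ t := by rintro rfl; exact (huvS _ ht).2.2.1 hy
    have := Finset.card_le_card hsub
    rw [Finset.card_eq_three.2 ⟨x, y, t, hxy, hxt, hyt, rfl⟩] at this
    have := hadm.degree_le w (hOS hw)
    exact Finset.card_eq_zero.1 (by omega)
  have hO4 : O.card ≤ 4 := by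
    have hsub : O ⊆ (D.nbrs S u).erase v ∪ (D.nbrs S v).erase u := by
      intro w hw
      have hwu : w ≠ u := by rintro rfl; exact huO hw
      have hwv : w ≠ v := by rintro rfl; exact hvO hw
      rcases Finset.mem_union.1 (hOW hw) with h | h
      · exact Finset.mem_union_left _ (Finset.mem_erase.2 ⟨hwv, h⟩)
      · exact Finset.mem_union_right _ (Finset.mem_erase.2 ⟨hwu, h⟩)
    have h1 := (Finset.card_le_card hsub).trans (Finset.card_union_le _ _)
    rw [Finset.card_erase_of_mem (mem_nbrs.2 ⟨hv, huv⟩),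
      Finset.card_erase_of_mem (mem_nbrs.2 ⟨hu, huv.symm⟩)] at h1
    have := hD3 u hu
    have := hD3 v hv
    omega
  obtain ⟨p, hp, q, hq, hpq, hCpq⟩ : ∃ p ∈ K, ∃ q ∈ K, p ≠ q ∧ ¬ C.Adj p q := by
    by_contra! hcon
    exact hadm.clique_free K hKS' ((isNClique_iff _).2
      ⟨fun x hx y hy hxy => hcon x hx y hy hxy, hK.card_eq⟩)
  obtain ⟨w, hwW, hwp, hwq⟩ : ∃ w ∈ W, D.Adj w p ∧ D.Adj w q := by
    rcases sup_adj .. |>.1 (hK.isClique hp hq hpq) with h | h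
    · exact absurd h hCpq
    · exact h.2
  have hwS : w ∈ S := hBS (hWB hwW)
  have hwO : w ∈ O := (hOm w).2 ⟨p, hp, hwS, hwp.symm⟩
  obtain ⟨t, ht, hwt⟩ := hOt w hwO
  -- The private edge that `w` provides at `p` can only be `pq`, so no other vertex of `O` links `p`
  -- and `q`.
  have huniq : ∀ w' ∈ O.erase w, ¬ (D.Adj w' p ∧ D.Adj w' q) := by
    rintro w' hw' ⟨h1, h2⟩
    rw [Finset.mem_erase] at hw'
    obtain ⟨y, hy, hyp, hwy, -, hpriv⟩ := (hat p hp).2.2 w (mem_nbrs.2 ⟨hwS, hwp.symm⟩)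
    rcases hthree w hwO p hp q hq hpq hwp hwq t ht hwt y (hKS' hy) hwy with rfl | rfl | rfl
    · exact hyp rfl
    · exact hpriv w' (hOS hw'.2) hw'.1 h1 h2
    · exact (huvS _ ht).2.2.1 hy
  have hCK : ∀ x ∈ K, C.nbrs S x ⊆ K := fun x hx => (hat x hx).1
  have hDK : ∀ x ∈ K, D.nbrs S x ⊆ O := fun x hx => Finset.subset_biUnion_of_mem (D.nbrs S) hx
  have hODT : ∀ T : Finset V, (∀ w ∈ O, ∀ t, t = u ∨ t = v → D.Adj w t → t ∈ T) →
      ∀ w ∈ O, D.nbrs S w ⊆ K ∪ T := by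
    intro T hT w hw z hz
    rw [mem_nbrs] at hz
    obtain ⟨x, hx, y, hy, hxy, hwx, hwy⟩ := hOxy w hw
    obtain ⟨t, ht, hwt⟩ := hOt w hw
    rcases hthree w hw x hx y hy hxy hwx hwy t ht hwt z hz.1 hz.2 with rfl | rfl | rfl
    exacts [Finset.mem_union_left _ hx, Finset.mem_union_left _ hy,
      Finset.mem_union_right _ (hT w hw _ ht hwt)]
  have hcardpos : 0 < O.card := Finset.card_pos.2 ⟨w, hwO⟩
  have hOerase := Finset.card_erase_of_mem hwO
  have huvm : ∀ t, t ∈ ({u, v} : Finset V) ↔ t = u ∨ t = v := by simp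
  -- Here `w` stays unchosen because it sees both `p` and `q`. The constant 6 counts `K` and `{u,
  -- v}`, and each of `u`, `v` serves as the unchosen d-neighbour of the other.
  have hgad : ∀ O' ⊆ O.erase w, (D.nbrs O' p).card ≤ 1 → (D.nbrs O' q).card ≤ 1 → O'.card ≤ 2 →
      6 + O.card ≤ 3 * (2 + O'.card) → HasLargeTwoLimited C D S := by
    intro O' hO' h1 h2 h3 h4
    have hO'O := hO'.trans (Finset.erase_subset w O)
    refine hadm.hasLarge_of_gadget ih hKS' hK.card_eq hCK hDK hOS hOK hOC
      (hODT {u, v} fun _ _ t ht _ => (huvm t).2 ht) (fun t ht => (huvS t ((huvm t).1 ht)).1)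
      (Finset.disjoint_left.2 fun t ht => (huvS t ((huvm t).1 ht)).2.2.1)
      (Finset.disjoint_left.2 fun t ht => (huvS t ((huvm t).1 ht)).2.2.2) ?_ hp hq hpq hCpq
      hO'O (fun w hw => huniq w (hO' hw)) h1 h2 h3 (by rw [Finset.card_pair huv.ne]; omega)
    intro t ht
    rcases (huvm t).1 ht with rfl | rfl
    · exact ⟨v, Finset.mem_union_right _ ((huvm v).2 (Or.inr rfl)), fun h => hvO (hO'O h), huv⟩
    · exact ⟨u, Finset.mem_union_right _ ((huvm u).2 (Or.inl rfl)), fun h => huO (hO'O h), huv.symm⟩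
  -- The cases choose 0, 1 and 2 vertices of `O`. For a single vertex `w`, deleting both `u` and `v`
  -- would cost seven vertices for two chosen ones, so only the neighbour `t` of `w` is deleted.
  obtain hO1 | hO23 | hO4' : O.card = 1 ∨ (2 ≤ O.card ∧ O.card ≤ 3) ∨ O.card = 4 := by omega
  · have hOeq : ∀ w' ∈ O, w' = w := fun w' hw' => Finset.card_le_one.1 hO1.le w' hw' w hwO
    refine hadm.hasLarge_of_gadget (O' := ∅) (T := {t}) ih hKS' hK.card_eq hCK hDK hOS hOK hOC
      (hODT {t} ?_) ?_ ?_ ?_ ?_ hp hq hpq hCpq (Finset.empty_subset _) ?_ ?_ ?_ ?_ ?_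
    · intro w' hw' t' ht' hwt'
      rw [hOeq w' hw'] at hwt'
      rw [Finset.mem_singleton]
      rcases hthree w hwO p hp q hq hpq hwp hwq t ht hwt t' (huvS t' ht').1 hwt' with rfl | rfl | h
      · exact absurd hp (huvS _ ht').2.2.1
      · exact absurd hq (huvS _ ht').2.2.1
      · exact h
    · exact Finset.singleton_subset_iff.2 (huvS t ht).1
    · exact Finset.disjoint_singleton_left.2 (huvS t ht).2.2.1
    · exact Finset.disjoint_singleton_left.2 (huvS t ht).2.2.2
    · intro t' ht'
      rw [Finset.mem_singleton.1 ht']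
      exact ⟨w, Finset.mem_union_left _ hwO, Finset.notMem_empty w, hwt.symm⟩
    · simp
    · simp [nbrs]
    · simp [nbrs]
    · simp
    · simp [hO1]
  · obtain ⟨w1, hw1⟩ : (O.erase w).Nonempty := Finset.card_pos.1 (by omega)
    have hle : ∀ x, (D.nbrs {w1} x).card ≤ 1 := fun x => Finset.card_filter_le _ _
    refine hgad {w1} (Finset.singleton_subset_iff.2 hw1) (hle p) (hle q) (by simp) ?_
    rw [Finset.card_singleton]
    omega
  -- Neither `p` nor `q` can see all four vertices of `O`, so two of the three other than `w` can be
  -- chosen with at most one seen by `p` and at most one by `q`.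
  · have hnotall : ∀ x ∈ K, D.Adj w x → ¬ ∀ w' ∈ O.erase w, D.Adj w' x := by
      intro x hx hwx hall
      have hsub : O ⊆ D.nbrs S x := by
        intro w' hw'
        refine mem_nbrs.2 ⟨hOS hw', ?_⟩
        by_cases h : w' = w
        · exact h ▸ hwx.symm
        · exact (hall w' (Finset.mem_erase.2 ⟨h, hw'⟩)).symm
      have := Finset.card_le_card hsub
      have := hD3 x (hKS' hx)
      omega
    obtain ⟨a, ha, b, hb, hab, hpab, hqab⟩ := Finset.exists_pair_of_card_eq_three (by omega)
      (hnotall p hp hwp) (hnotall q hq hwq) huniq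
    have hle : ∀ x, ¬ (D.Adj a x ∧ D.Adj b x) → (D.nbrs {a, b} x).card ≤ 1 := by
      intro x hx
      rw [Finset.card_le_one]
      intro y hy z hz
      simp only [mem_nbrs, Finset.mem_insert, Finset.mem_singleton] at hy hz
      rcases hy with ⟨rfl | rfl, h1⟩ <;> rcases hz with ⟨rfl | rfl, h2⟩
      exacts [rfl, absurd ⟨h1.symm, h2.symm⟩ hx, absurd ⟨h2.symm, h1.symm⟩ hx, rfl]
    refine hgad {a, b} ?_ (hle p hpab) (hle q hqab) Finset.card_le_two ?_
    · exact Finset.insert_subset ha (Finset.singleton_subset_iff.2 hb)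
    · rw [Finset.card_pair hab]
      omega

theorem IsAdmissibleOn.hasLarge {C D : SimpleGraph V} {S : Finset V}
    (hadm : IsAdmissibleOn C D S) : HasLargeTwoLimited C D S := by
  -- `C` must vary because the reduction adds c-edges; `D` stays fixed.
  induction h : S.card using Nat.strong_induction_on generalizing C S with
  | _ n ih =>
  have ih' : ∀ R ⊂ S, ∀ C' : SimpleGraph V, IsAdmissibleOn C' D R → HasLargeTwoLimited C' D R :=
    fun R hR C' hR' => ih R.card (h ▸ Finset.card_lt_card hR) hR' rfl
  by_cases hex : ∃ u ∈ S, ∃ v ∈ S, D.Adj u v ∧ ¬ C.Adj u v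
  · obtain ⟨u, hu, v, hv, huv, hCuv⟩ := hex
    have hBS := edgeBall_subset (C := C) (D := D) hu hv
    have hWB : D.nbrs S u ∪ D.nbrs S v ⊆ edgeBall C D S u v := by
      intro z hz
      rw [Finset.mem_union, mem_nbrs, mem_nbrs] at hz
      rw [mem_edgeBall]
      tauto
    have hW2 : ∀ w ∈ D.nbrs S u ∪ D.nbrs S v,
        (D.nbrs (S \ edgeBall C D S u v) w).card ≤ 2 := by
      intro w hw
      have hd := hadm.degree_le w (hBS (hWB hw))
      rcases Finset.mem_union.1 hw with h | h
      · have := card_nbrs_sdiff_add_one_le (D := D) (B := edgeBall C D S u v) hu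
          (mem_edgeBall.2 (Or.inl rfl)) (mem_nbrs.1 h).2.symm
        omega
      · have := card_nbrs_sdiff_add_one_le (D := D) (B := edgeBall C D S u v) hv
          (mem_edgeBall.2 (Or.inr (Or.inl rfl))) (mem_nbrs.1 h).2.symm
        omega
    by_cases hK : ∃ K ⊆ S \ edgeBall C D S u v,
        (C ⊔ D.linkThrough (D.nbrs S u ∪ D.nbrs S v)).IsNClique 4 K
    · obtain ⟨K, hKS, hK⟩ := hK
      exact hadm.hasLarge_of_clique (fun R hR => ih' R hR C) hu hv huv hW2 hWB hKS hK
    · push Not at hK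
      refine hadm.hasLarge_of_edge hu hv huv hCuv (ih' _ ?_ _
        ⟨degree_le_sup_linkThrough hadm.degree_le hBS hWB hW2, hK⟩)
      exact (Finset.ssubset_iff_of_subset Finset.sdiff_subset).2
        ⟨u, hu, fun h => (Finset.mem_sdiff.1 h).2 (mem_edgeBall.2 (Or.inl rfl))⟩
  · push Not at hex
    exact hadm.hasLarge_of_le hex

end Subcubic

end SimpleGraph

/-! ### Transfer from multigraphs to the two simple graphs. -/

namespace Graph

section Kind

open scoped Classical

variable {α β : Type*}

/-- The simple graph whose edges are the pairs of distinct vertices joined by an edge of kind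
`k`. -/
def kindGraph (G : Graph α β) (kind : β → EdgeKind) (k : EdgeKind) : SimpleGraph α where
  Adj u v := u ≠ v ∧ ∃ e, kind e = k ∧ G.IsLink e u v
  symm := ⟨fun _ _ h => ⟨h.1.symm, h.2.imp fun _ he => ⟨he.1, he.2.symm⟩⟩⟩
  loopless := ⟨fun _ h => h.1 rfl⟩

/-- Sending an edge at `v` to its other end covers all neighbours; parallel edges only make the
neighbour count smaller. The value `v` off the incident edges is a dummy. -/
lemma card_nbrs_kindGraph_le {G : Graph α β} {kind : β → EdgeKind} {k : EdgeKind} {S : Finset α}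
    {v : α} {I : Finset β} (hI : ∀ e, e ∈ I ↔ G.Inc e v) :
    ((G.kindGraph kind k).nbrs S v).card ≤ ({e ∈ I | kind e = k} : Finset β).card := by
  have hsub : (G.kindGraph kind k).nbrs S v ⊆
      ({e ∈ I | kind e = k} : Finset β).image fun e => if h : G.Inc e v then h.other else v := by
    intro u hu
    obtain ⟨-, -, e, hek, he⟩ := SimpleGraph.mem_nbrs.1 hu
    refine Finset.mem_image.2 ⟨e, Finset.mem_filter.2 ⟨(hI e).2 he.inc_left, hek⟩, ?_⟩
    rw [dif_pos he.inc_left]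
    exact (Inc.isLink_other he.inc_left).right_unique he
  exact (Finset.card_le_card hsub).trans Finset.card_image_le

lemma MaxDegreeLeThree.exists_finset {G : Graph α β} (h : G.MaxDegreeLeThree) {v : α}
    (hv : v ∈ V(G)) : ∃ I : Finset β, (∀ e, e ∈ I ↔ G.Inc e v) ∧ I.card ≤ 3 := by
  have h3 := h v hv
  have hfin : (G.incidenceSet v).Finite :=
    Set.finite_of_encard_le_coe (k := 3) (by exact_mod_cast h3)
  refine ⟨hfin.toFinset, fun e => by simp, ?_⟩
  rw [hfin.encard_eq_coe_toFinset_card] at h3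
  exact_mod_cast h3

lemma MaxDegreeLeThree.kindGraph_degree_le {G : Graph α β} (h : G.MaxDegreeLeThree)
    (kind : β → EdgeKind) (S : Finset α) {v : α} (hv : v ∈ V(G)) :
    ((G.kindGraph kind .c).nbrs S v).card + ((G.kindGraph kind .d).nbrs S v).card ≤ 3 := by
  obtain ⟨I, hI, hI3⟩ := h.exists_finset hv
  have hc := card_nbrs_kindGraph_le (kind := kind) (k := .c) (S := S) hI
  have hd := card_nbrs_kindGraph_le (kind := kind) (k := .d) (S := S) hI
  have hdisj : Disjoint ({e ∈ I | kind e = .c} : Finset β) ({e ∈ I | kind e = .d} : Finset β) := by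
    refine Finset.disjoint_left.2 fun e he he' => ?_
    rw [Finset.mem_filter] at he he'
    exact EdgeKind.noConfusion (he.2.symm.trans he'.2)
  have hle := Finset.card_le_card (Finset.union_subset (Finset.filter_subset (kind · = .c) I)
    (Finset.filter_subset (kind · = .d) I))
  rw [Finset.card_union_of_disjoint hdisj] at hle
  omega

/-- The edges at a vertex `x` of a 4-clique `K` of c-edges are three c-edges to the other vertices
of `K`. -/
lemma MaxDegreeLeThree.inc_of_clique {G : Graph α β} (h : G.MaxDegreeLeThree)
    {kind : β → EdgeKind} {K : Finset α} (hKG : ∀ x ∈ K, x ∈ V(G))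
    (hK : (G.kindGraph kind .c).IsNClique 4 K) {x : α} (hx : x ∈ K) :
    (∀ e, G.Inc e x → kind e = .c ∧ ∃ y ∈ K, G.IsLink e x y) ∧
      ∀ e f y, G.IsLink e x y → G.IsLink f x y → e = f := by
  obtain ⟨I, hI, hI3⟩ := h.exists_finset (hKG x hx)
  have hex : ∀ y : K.erase x, ∃ e, kind e = .c ∧ G.IsLink e x y := by
    rintro ⟨y, hy⟩
    rw [Finset.mem_erase] at hy
    exact (hK.isClique hx hy.2 hy.1.symm).2
  choose g hg using hex
  have hinj : Function.Injective g := fun y z hyz =>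
    Subtype.ext ((hg y).2.right_unique (hyz ▸ (hg z).2))
  -- The clique supplies three distinct edges at `x`, and there are at most three in all.
  have himg : Finset.univ.image g = I := by
    apply Finset.eq_of_subset_of_card_le
    · intro e he
      obtain ⟨y, -, rfl⟩ := Finset.mem_image.1 he
      exact (hI _).2 (hg y).2.inc_left
    · rw [Finset.card_image_of_injective _ hinj, Finset.card_univ, Fintype.card_coe,
        Finset.card_erase_of_mem hx, hK.card_eq]
      exact hI3
  have hall : ∀ e, G.Inc e x → ∃ y, g y = e := by
    intro e he
    have := (hI e).2 he
    rw [← himg] at this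
    obtain ⟨y, -, hy⟩ := Finset.mem_image.1 this
    exact ⟨y, hy⟩
  refine ⟨fun e he => ?_, fun e f y he hf => ?_⟩
  · obtain ⟨y, rfl⟩ := hall e he
    exact ⟨(hg y).1, y, Finset.mem_of_mem_erase y.2, (hg y).2⟩
  · obtain ⟨z, rfl⟩ := hall e he.inc_left
    obtain ⟨w, rfl⟩ := hall f hf.inc_left
    have h1 := (hg z).2.right_unique he
    have h2 := (hg w).2.right_unique hf
    rw [Subtype.ext (h1.trans h2.symm)]

lemma MaxDegreeLeThree.isCK4Component_induce {G : Graph α β} (h : G.MaxDegreeLeThree)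
    (hloop : G.Loopless) {kind : β → EdgeKind} {K : Finset α} (hKG : ∀ x ∈ K, x ∈ V(G))
    (hK : (G.kindGraph kind .c).IsNClique 4 K) :
    (G.induce (K : Set α)).IsCK4Component G kind where
  closed := by
    -- No edge leaves `K`, since the clique uses up the degree of its vertices; a c-coloured `K₄` is
    -- therefore a whole component.
    refine IsClosedSubgraph.mk' (induce_le hKG) fun e x he hx => ?_
    obtain ⟨-, y, hy, hxy⟩ := (h.inc_of_clique hKG hK (Finset.mem_coe.1 hx)).1 e he
    exact IsLink.edge_mem (x := x) (y := y) ⟨hxy, hx, hy⟩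
  four := by
    rw [vertexSet_induce, Set.encard_coe_eq_coe_finsetCard, hK.card_eq]
    rfl
  simple :=
    { not_isLoopAt := fun e x hex => hloop.not_isLoopAt e x hex.1
      eq_of_isLink := fun e f x y he hf =>
        (h.inc_of_clique hKG hK (Finset.mem_coe.1 he.2.1)).2 e f y he.1 hf.1 }
  complete x hx y hy hxy := by
    obtain ⟨-, e, -, he⟩ := hK.isClique hx hy hxy
    exact ⟨e, he, hx, hy⟩
  all_c e he := by
    obtain ⟨x, y, hxy, hx, -⟩ := exists_isLink_of_mem_edgeSet he
    exact ((h.inc_of_clique hKG hK (Finset.mem_coe.1 hx)).1 e hxy.inc_left).1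

end Kind

end Graph

theorem theorem1 {α β : Type*} (G : Graph α β) (kind : β → EdgeKind)
    (hfin : V(G).Finite) (hloop : G.Loopless) (hdeg : G.MaxDegreeLeThree)
    (hK4 : ¬ ∃ H : Graph α β, H.IsCK4Component G kind) :
    ∃ X : Set α, G.IsTwoLimited kind X ∧ (V(G).ncard : ℚ) / 3 ≤ (X.ncard : ℚ) := by
  classical
  have hmem : ∀ x, x ∈ hfin.toFinset ↔ x ∈ V(G) := fun x => hfin.mem_toFinset
  have hadm : SimpleGraph.IsAdmissibleOn (G.kindGraph kind .c) (G.kindGraph kind .d)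
      hfin.toFinset :=
    ⟨fun v hv => hdeg.kindGraph_degree_le kind _ ((hmem v).1 hv), fun K hKS hK => hK4
      ⟨_, hdeg.isCK4Component_induce hloop (fun x hx => (hmem x).1 (hKS hx)) hK⟩⟩
  obtain ⟨X, hX, hcard⟩ := hadm.hasLarge
  refine ⟨X, ⟨fun x hx => (hmem x).1 (hX.subset hx), fun e u v hec he => ?_, fun v hv => ?_⟩, ?_⟩
  · rw [Set.encard_le_one_iff]
    rintro a b ⟨ha, ha'⟩ ⟨hb, hb'⟩
    by_contra hab
    refine hX.indep a ha b hb ⟨hab, e, hec, ?_⟩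
    rcases ha' with rfl | rfl <;> rcases hb' with rfl | rfl
    exacts [absurd rfl hab, he, he.symm, absurd rfl hab]
  · have hsub : (X : Set α) ∩ G.closedDNbhd kind v ⊆
        ((X ∩ insert v ((G.kindGraph kind .d).nbrs hfin.toFinset v) : Finset α) : Set α) := by
      rintro u ⟨huX, hu⟩
      rw [Finset.mem_coe, Finset.mem_inter, Finset.mem_insert]
      refine ⟨huX, hu.imp id ?_⟩
      rintro ⟨e, hed, he⟩
      exact SimpleGraph.mem_nbrs.2 ⟨(hmem u).2 he.left_mem, he.ne.symm, e, hed, he.symm⟩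
    refine (Set.encard_le_encard hsub).trans ?_
    rw [Set.encard_coe_eq_coe_finsetCard]
    exact_mod_cast hX.nbhd v ((hmem v).2 hv)
  · rw [Set.ncard_eq_toFinset_card _ hfin, Set.ncard_coe_finset, div_le_iff₀ (by norm_num),
      mul_comm]
    exact_mod_cast hcard
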